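/- **Theorem (Delaunay-type theorem).** Let $\mathbb{E}^3_1$ be $\mathbb{R}^3$ with the metric $\langle u,v\rangle=u_1v_1+u_2v_2-u_3v_3$. Let $I\subset\mathbb{R}$ be an open interval and let $\gamma:I\to\mathbb{E}^3_1$, $\gamma(s)=(x(s),y(s),0)$, be a $C^2$ curve in the spacelike $xy$-plane, parametrized by arc length ($x'^2+y'^2=1$), with $y>0$. Let $S_\gamma$ be the (timelike) surface of revolution about the spacelike axis $Ox$ given by $$X(s,\theta)=(x(s),\,y(s)\cosh\theta,\,y(s)\sinh\theta),\qquad (s,\theta)\in I\times\mathbb{R},$$ with mean curvature $H=\frac{\epsilon}{2}\,\frac{g_{11}h_{22}-2g_{12}h_{12}+g_{22}h_{11}}{g_{11}g_{22}-g_{12}^2}$, where $g_{ij}$ and $h_{ij}$ are the coefficients of the first and second fundamental forms with respect to the unit normal $N=X_s\times X_\theta/\sqrt{|\langle X_s\times X_\theta,X_s\times X_\theta\rangle|}$, $\times$ is the Lorentzian cross product and $\epsilon=\langle N,N\rangle$. Then $S_\gamma$ has constant mean curvature if and only if one of the following holds: 1. $\gamma$ is an arc of the roulette of a conic in the $xy$-plane,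 that is, $\gamma$ is traced by a focus of a nondegenerate conic (an ellipse, possibly a circle, a parabola, or a hyperbola) which rolls without slipping along the axis $Ox$; 2. $\gamma$ is an arc of a circle centred on $Ox$; 3. $\gamma$ is a segment of a line perpendicular to $Ox$. (Cases 2 and 3 are the limits of case 1 for degenerate conics.) Here, rolling without slipping along $Ox$ means that the conic is moved by differentiable direct isometries $M_s$ of the Euclidean $xy$-plane, $s\in I$, such that for each $s$ the axis $Ox$ is tangent to the moved conic and the point of the moving conic that is in contact with $Ox$ has velocity zero. A hyperbola is rolled with both its branches: it may pass from one branch to the other at a time at which $Ox$ is an asymptote of the moved hyperbola (contact at infinity), the motion being at that time instantaneously a translation perpendicular to $Ox$. -/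

import Mathlib

noncomputable section

namespace Delaunay

/-! ### Surfaces in Lorentz-Minkowski space -/

/-- The index one metric of Lorentz-Minkowski space, `u₁v₁ + u₂v₂ - u₃v₃`. -/
def minkowski (u v : Fin 3 → ℝ) : ℝ := u 0 * v 0 + u 1 * v 1 - u 2 * v 2

/-- The cross product of Lorentz-Minkowski space. -/
def lorentzCross (u v : Fin 3 → ℝ) : Fin 3 → ℝ :=
  ![u 1 * v 2 - u 2 * v 1, -(u 0 * v 2 - u 2 * v 0), -(u 0 * v 1 - u 1 * v 0)]

/-- The unit normal field `N = (X_u × X_v) / √|⟨X_u × X_v, X_u × X_v⟩|`. -/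
def unitNormal (X : ℝ → ℝ → Fin 3 → ℝ) (u v : ℝ) : Fin 3 → ℝ :=
  let n := lorentzCross (deriv (fun a => X a v) u) (deriv (fun b => X u b) v)
  (√|minkowski n n|)⁻¹ • n

/-- The mean curvature of a parametrized surface, computed from the coefficients of the first
and second fundamental forms:
`H = (ε / 2) (g₁₁ h₂₂ - 2 g₁₂ h₁₂ + g₂₂ h₁₁) / (g₁₁ g₂₂ - g₁₂²)` with `ε = ⟨N, N⟩`. -/
def meanCurvature (X : ℝ → ℝ → Fin 3 → ℝ) (u v : ℝ) : ℝ :=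
  let Xu := deriv (fun a => X a v) u
  let Xv := deriv (fun b => X u b) v
  let Xuu := deriv (fun a => deriv (fun a' => X a' v) a) u
  let Xuv := deriv (fun b => deriv (fun a => X a b) u) v
  let Xvv := deriv (fun b => deriv (fun b' => X u b') b) v
  let N := unitNormal X u v
  let g₁₁ := minkowski Xu Xu
  let g₁₂ := minkowski Xu Xv
  let g₂₂ := minkowski Xv Xv
  let h₁₁ := minkowski Xuu N
  let h₁₂ := minkowski Xuv N
  let h₂₂ := minkowski Xvv N
  minkowski N N / 2 * ((g₁₁ * h₂₂ - 2 * g₁₂ * h₁₂ + g₂₂ * h₁₁) / (g₁₁ * g₂₂ - g₁₂ ^ 2))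

/-- The rotation by `θ` about the spacelike `x`-axis. -/
def rotX (θ : ℝ) : Matrix (Fin 3) (Fin 3) ℝ :=
  !![1, 0, 0;
     0, Real.cosh θ, Real.sinh θ;
     0, Real.sinh θ, Real.cosh θ]

/-- The surface of revolution about the `x`-axis generated by the curve `γ`. -/
def revolutionSurface (γ : ℝ → Fin 3 → ℝ) (s θ : ℝ) : Fin 3 → ℝ :=
  Matrix.mulVec (rotX θ) (γ s)

/-! ### Conics and roulettes in the spacelike `xy`-plane -/

/-- The point `(x, y, 0)` of the `xy`-plane, written as the complex number `x + i y`. -/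
def toPlane (v : Fin 3 → ℝ) : ℂ := ⟨v 0, v 1⟩

/-- The metric induced on the `xy`-plane is the Euclidean metric of `ℂ`. -/
theorem minkowski_self_of_plane (v : Fin 3 → ℝ) (hv : v 2 = 0) :
    minkowski v v = Complex.normSq (toPlane v) := by
  simp [minkowski, toPlane, Complex.normSq_apply, hv]

/-- `K` is a nondegenerate conic (an ellipse, possibly a circle, a parabola, or a hyperbola with
both its branches) and `F` is one of its foci. -/
def IsConicWithFocus (K : Set ℂ) (F : ℂ) : Prop :=
  (∃ (G : ℂ) (a : ℝ), dist F G < 2 * a ∧ K = {z | dist z F + dist z G = 2 * a}) ∨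
  (∃ A B : ℂ, A ≠ B ∧ F ∉ line[ℝ, A, B] ∧
    K = {z | dist z F = Metric.infDist z (line[ℝ, A, B] : Set ℂ)}) ∨
  (∃ (G : ℂ) (a : ℝ), 0 < a ∧ 2 * a < dist F G ∧ K = {z | |dist z F - dist z G| = 2 * a})

/-- The `x`-axis is tangent to the plane set `K` at its point `q`. -/
def AxisTangentAt (K : Set ℂ) (q : ℂ) : Prop :=
  q ∈ K ∧ q.im = 0 ∧ (1 : ℂ) ∈ tangentConeAt ℝ K q

/-- The `x`-axis is an asymptote of the plane set `K`: there are points of `K` arbitrarily far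
away and arbitrarily close to the axis. Among the conics only hyperbolas have asymptotes. -/
def AxisAsymptote (K : Set ℂ) : Prop :=
  ∀ R : ℝ, ∀ ε > 0, ∃ q ∈ K, R < ‖q‖ ∧ |q.im| < ε

/-- The rigid motions `z ↦ u s * z + w s`, `s ∈ I`, of the plane (with `|u s| = 1`) roll the set
`K` along the `x`-axis without slipping.  At each time the `x`-axis is tangent to the moved copy
of `K`, and the point of contact, as a point attached to the moving copy, is instantaneously at
rest.  At the exceptional times at which the axis is an asymptote (a hyperbola passing from one
branch to the other) the point of contact, which is the centre of the instantaneous rotation, lies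
at infinity on the axis: the motion is then instantaneously a translation perpendicular to the
axis. -/
def RollsAlongAxis (K : Set ℂ) (I : Set ℝ) (u w : ℝ → ℂ) : Prop :=
  ∀ s ∈ I, ‖u s‖ = 1 ∧ DifferentiableAt ℝ u s ∧ DifferentiableAt ℝ w s ∧
    ((∃ p ∈ K, AxisTangentAt ((fun z => u s * z + w s) '' K) (u s * p + w s) ∧
        deriv (fun t => u t * p + w t) s = 0) ∨
      (AxisAsymptote ((fun z => u s * z + w s) '' K) ∧ deriv u s = 0 ∧ (deriv w s).re = 0))

/-- The plane curve `c`, on the parameter set `I`, is (an arc of) the roulette of a conic: the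
curve traced by a focus of a conic which rolls without slipping along the `x`-axis. -/
def IsConicRoulette (c : ℝ → ℂ) (I : Set ℝ) : Prop :=
  ∃ (K : Set ℂ) (F : ℂ) (u w : ℝ → ℂ), IsConicWithFocus K F ∧ RollsAlongAxis K I u w ∧
    ∀ s ∈ I, c s = u s * F + w s

end Delaunay

end

namespace Delaunay

open Filter Topology Set ComplexConjugate

/-! Everything reduces to the profile: with κ = x'y'' - y'x'' the surface satisfies 2H = x'/y - κ,
independently of θ (`meanCurvature_revolutionSurface`). Multiplying by y y' and integrating gives y
x' - H y² = C. If C = 0 then x' = H y, which is a vertical line (H = 0) or a circle of radius 1/|H|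
centred on the axis.

If C ≠ 0, let q be the point where the normal of γ meets the axis, at signed distance y/x' from γ. A
motion that carries a point along γ and is instantaneously a rotation about q has angular velocity
-x'/y. The equation 2H = x'/y - κ says exactly that the vector (x' - 2Hy, -y') turns at this speed
(`hasDerivAt_spin`, `constant_meanCurvature_of_spin`). For H ≠ 0 this vector, turned by a right
angle and divided by H, joins γ to the point G whose mirror image in the axis lies on the normal at
signed distance 1/H from γ. So G is fixed in the moving frame, and the distances from q to γ and to
G are |y/x'| and |y/x' - 1/H|. Their sum or difference is 1/|H|: in the moving frame q describes an
ellipse if CH > 0, a hyperbola if CH < 0. For H = 0 the vector is the direction of the directrix of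
a parabola.

Conversely, the reflection property of a rolling conic puts the mirror image of the second focus on
the normal at signed distance ±2a (for a parabola, it makes the directrix parallel to the mirrored
tangent), and the spin equation gives back constant H (`rolling_cases`, `reflection_central`). -/

/-- The profile `(x, y)` on `I`: a twice differentiable unit speed curve in the upper half plane,
with first derivative `(x₁, y₁)` and second derivative `(x₂, y₂)`. -/
structure IsProfile (I : Set ℝ) (x y x₁ y₁ x₂ y₂ : ℝ → ℝ) : Prop where
  isOpen : IsOpen I
  isPreconnected : IsPreconnected I
  hx : ∀ s ∈ I, HasDerivAt x (x₁ s) s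
  hy : ∀ s ∈ I, HasDerivAt y (y₁ s) s
  hx₁ : ∀ s ∈ I, HasDerivAt x₁ (x₂ s) s
  hy₁ : ∀ s ∈ I, HasDerivAt y₁ (y₂ s) s
  pos : ∀ s ∈ I, 0 < y s
  unit : ∀ s ∈ I, x₁ s ^ 2 + y₁ s ^ 2 = 1

/-! ### Mean curvature in terms of the profile. -/

theorem revolutionSurface_eq (γ : ℝ → Fin 3 → ℝ) (s θ : ℝ) :
    revolutionSurface γ s θ = ![γ s 0, γ s 1 * Real.cosh θ + γ s 2 * Real.sinh θ,
      γ s 1 * Real.sinh θ + γ s 2 * Real.cosh θ] := by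
  ext i
  fin_cases i <;>
    simp [revolutionSurface, rotX, Matrix.mulVec, dotProduct, Fin.sum_univ_three] <;> ring

theorem hasDerivAt_vec3 {f g h : ℝ → ℝ} {f' g' h' t : ℝ} (hf : HasDerivAt f f' t)
    (hg : HasDerivAt g g' t) (hh : HasDerivAt h h' t) :
    HasDerivAt (fun t => ![f t, g t, h t]) ![f', g', h'] t := by
  rw [hasDerivAt_pi]
  intro i
  fin_cases i <;> simpa

section meanCurvature

variable {I : Set ℝ} {γ : ℝ → Fin 3 → ℝ} {x₁ y₁ x₂ y₂ : ℝ → ℝ}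

theorem meanCurvature_revolutionSurface
    (hγ : IsProfile I (fun s => γ s 0) (fun s => γ s 1) x₁ y₁ x₂ y₂)
    (hplane : ∀ s ∈ I, γ s 2 = 0) {s : ℝ} (hs : s ∈ I) (θ : ℝ) :
    meanCurvature (revolutionSurface γ) s θ
      = (x₁ s / γ s 1 + x₂ s * y₁ s - y₂ s * x₁ s) / 2 := by
  have hz : ∀ t ∈ I, HasDerivAt (fun s => γ s 2) 0 t := fun t ht =>
    (hasDerivAt_const t (0 : ℝ)).congr_of_eventuallyEq
      ((hγ.isOpen.eventually_mem ht).mono fun r hr => hplane r hr)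
  have hnhds := hγ.isOpen.eventually_mem hs
  have hu : ∀ b, ∀ t ∈ I, HasDerivAt (fun a => revolutionSurface γ a b)
      ![x₁ t, y₁ t * Real.cosh b, y₁ t * Real.sinh b] t := by
    intro b t ht
    simp only [revolutionSurface_eq]
    refine hasDerivAt_vec3 (hγ.hx t ht) ?_ ?_
    · simpa using ((hγ.hy t ht).mul_const (Real.cosh b)).fun_add
        ((hz t ht).mul_const (Real.sinh b))
    · simpa using ((hγ.hy t ht).mul_const (Real.sinh b)).fun_add
        ((hz t ht).mul_const (Real.cosh b))
  have hu' : ∀ b, deriv (fun a => revolutionSurface γ a b) s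
      = ![x₁ s, y₁ s * Real.cosh b, y₁ s * Real.sinh b] := fun b => (hu b s hs).deriv
  have huu : deriv (fun a => deriv (fun a' => revolutionSurface γ a' θ) a) s
      = ![x₂ s, y₂ s * Real.cosh θ, y₂ s * Real.sinh θ] := by
    have : (fun a => deriv (fun a' => revolutionSurface γ a' θ) a) =ᶠ[𝓝 s]
        fun t => ![x₁ t, y₁ t * Real.cosh θ, y₁ t * Real.sinh θ] :=
      hnhds.mono fun t ht => (hu θ t ht).deriv
    rw [this.deriv_eq]
    exact (hasDerivAt_vec3 (hγ.hx₁ s hs) ((hγ.hy₁ s hs).mul_const _)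
      ((hγ.hy₁ s hs).mul_const _)).deriv
  have hv : ∀ b, deriv (fun b => revolutionSurface γ s b) b
      = ![0, γ s 1 * Real.sinh b, γ s 1 * Real.cosh b] := by
    intro b
    simp only [revolutionSurface_eq, hplane s hs, zero_mul, add_zero]
    exact (hasDerivAt_vec3 (hasDerivAt_const b _) ((Real.hasDerivAt_cosh b).const_mul _)
      ((Real.hasDerivAt_sinh b).const_mul _)).deriv
  have hvv : deriv (fun b => deriv (fun b' => revolutionSurface γ s b') b) θ
      = ![0, γ s 1 * Real.cosh θ, γ s 1 * Real.sinh θ] := by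
    simp only [hv]
    exact (hasDerivAt_vec3 (hasDerivAt_const θ _) ((Real.hasDerivAt_sinh θ).const_mul _)
      ((Real.hasDerivAt_cosh θ).const_mul _)).deriv
  have huv : deriv (fun b => deriv (fun a => revolutionSurface γ a b) s) θ
      = ![0, y₁ s * Real.sinh θ, y₁ s * Real.cosh θ] := by
    simp only [hu']
    exact (hasDerivAt_vec3 (hasDerivAt_const θ _) ((Real.hasDerivAt_cosh θ).const_mul _)
      ((Real.hasDerivAt_sinh θ).const_mul _)).deriv
  have hpos : 0 < γ s 1 := hγ.pos s hs
  have hone := hγ.unit s hs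
  have hch := Real.cosh_sq θ
  have hN : unitNormal (revolutionSurface γ) s θ
      = ![y₁ s, -(x₁ s * Real.cosh θ), -(x₁ s * Real.sinh θ)] := by
    have hcross : lorentzCross ![x₁ s, y₁ s * Real.cosh θ, y₁ s * Real.sinh θ]
        ![0, γ s 1 * Real.sinh θ, γ s 1 * Real.cosh θ]
        = γ s 1 • ![y₁ s, -(x₁ s * Real.cosh θ), -(x₁ s * Real.sinh θ)] := by
      ext i
      fin_cases i <;> simp [lorentzCross] <;> grind
    have hnorm : minkowski (γ s 1 • ![y₁ s, -(x₁ s * Real.cosh θ), -(x₁ s * Real.sinh θ)])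
        (γ s 1 • ![y₁ s, -(x₁ s * Real.cosh θ), -(x₁ s * Real.sinh θ)]) = γ s 1 ^ 2 := by
      simp [minkowski]
      linear_combination γ s 1 ^ 2 * hone + γ s 1 ^ 2 * x₁ s ^ 2 * hch
    simp only [unitNormal, hu', hv, hcross, hnorm]
    rw [abs_of_nonneg (sq_nonneg _), Real.sqrt_sq hpos.le, smul_smul,
      inv_mul_cancel₀ hpos.ne', one_smul]
  simp only [meanCurvature, hN, huu, hvv, huv]
  simp only [hu', hv]
  have e1 : minkowski ![y₁ s, -(x₁ s * Real.cosh θ), -(x₁ s * Real.sinh θ)]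
      ![y₁ s, -(x₁ s * Real.cosh θ), -(x₁ s * Real.sinh θ)] = 1 := by
    simp [minkowski]
    linear_combination hone + x₁ s ^ 2 * hch
  have e2 : minkowski ![x₁ s, y₁ s * Real.cosh θ, y₁ s * Real.sinh θ]
      ![x₁ s, y₁ s * Real.cosh θ, y₁ s * Real.sinh θ] = 1 := by
    simp [minkowski]
    linear_combination hone + y₁ s ^ 2 * hch
  have e3 : minkowski ![x₁ s, y₁ s * Real.cosh θ, y₁ s * Real.sinh θ]
      ![0, γ s 1 * Real.sinh θ, γ s 1 * Real.cosh θ] = 0 := by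
    simp [minkowski]
    ring
  have e4 : minkowski ![0, γ s 1 * Real.sinh θ, γ s 1 * Real.cosh θ]
      ![0, γ s 1 * Real.sinh θ, γ s 1 * Real.cosh θ] = -γ s 1 ^ 2 := by
    simp [minkowski]
    linear_combination -γ s 1 ^ 2 * hch
  have e5 : minkowski ![0, γ s 1 * Real.cosh θ, γ s 1 * Real.sinh θ]
      ![y₁ s, -(x₁ s * Real.cosh θ), -(x₁ s * Real.sinh θ)] = -(γ s 1 * x₁ s) := by
    simp [minkowski]
    linear_combination -γ s 1 * x₁ s * hch
  have e6 : minkowski ![x₂ s, y₂ s * Real.cosh θ, y₂ s * Real.sinh θ]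
      ![y₁ s, -(x₁ s * Real.cosh θ), -(x₁ s * Real.sinh θ)] = x₂ s * y₁ s - y₂ s * x₁ s := by
    simp [minkowski]
    linear_combination -y₂ s * x₁ s * hch
  rw [e1, e2, e3, e4, e5, e6]
  field_simp
  ring

theorem isProfile_of_contDiffOn (hIopen : IsOpen I) (hIconn : I.OrdConnected)
    (hγ : ContDiffOn ℝ 2 γ I) (hplane : ∀ s ∈ I, γ s 2 = 0) (hpos : ∀ s ∈ I, 0 < γ s 1)
    (hunit : ∀ s ∈ I, minkowski (deriv γ s) (deriv γ s) = 1) :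
    IsProfile I (fun s => γ s 0) (fun s => γ s 1) (fun s => deriv γ s 0) (fun s => deriv γ s 1)
      (fun s => deriv (deriv γ) s 0) (fun s => deriv (deriv γ) s 1) := by
  have h1 : ∀ s ∈ I, HasDerivAt γ (deriv γ s) s := fun s hs =>
    ((hγ.differentiableOn (by norm_num)).differentiableAt (hIopen.mem_nhds hs)).hasDerivAt
  have h2 : ∀ s ∈ I, HasDerivAt (deriv γ) (deriv (deriv γ) s) s := fun s hs =>
    (((hγ.deriv_of_isOpen (m := 1) hIopen (by norm_num)).differentiableOn
      (by norm_num)).differentiableAt (hIopen.mem_nhds hs)).hasDerivAt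
  refine ⟨hIopen, hIconn.isPreconnected, fun s hs => hasDerivAt_pi.1 (h1 s hs) 0,
    fun s hs => hasDerivAt_pi.1 (h1 s hs) 1, fun s hs => hasDerivAt_pi.1 (h2 s hs) 0,
    fun s hs => hasDerivAt_pi.1 (h2 s hs) 1, hpos, fun s hs => ?_⟩
  have hz : deriv γ s 2 = 0 := (hasDerivAt_pi.1 (h1 s hs) 2).unique
    ((hasDerivAt_const s (0 : ℝ)).congr_of_eventuallyEq
      ((hIopen.eventually_mem hs).mono fun r hr => hplane r hr))
  have := hunit s hs
  simp only [minkowski, hz] at this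
  linarith

end meanCurvature

/-! ### Frenet equations of the profile. -/

namespace IsProfile

variable {I : Set ℝ} {x y x₁ y₁ x₂ y₂ : ℝ → ℝ}

theorem acceleration_orthogonal (h : IsProfile I x y x₁ y₁ x₂ y₂) {s : ℝ} (hs : s ∈ I) :
    x₁ s * x₂ s + y₁ s * y₂ s = 0 := by
  have h1 := ((h.hx₁ s hs).pow 2).add ((h.hy₁ s hs).pow 2)
  have h2 : HasDerivAt (x₁ ^ 2 + y₁ ^ 2) 0 s :=
    (hasDerivAt_const s (1 : ℝ)).congr_of_eventuallyEq
      ((h.isOpen.eventually_mem hs).mono fun r hr => h.unit r hr)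
  have := h1.unique h2
  norm_num at this
  linarith

theorem acceleration_fst (h : IsProfile I x y x₁ y₁ x₂ y₂) {s : ℝ} (hs : s ∈ I) :
    x₂ s = -(x₁ s * y₂ s - y₁ s * x₂ s) * y₁ s := by
  linear_combination -x₂ s * h.unit s hs + x₁ s * h.acceleration_orthogonal hs

theorem acceleration_snd (h : IsProfile I x y x₁ y₁ x₂ y₂) {s : ℝ} (hs : s ∈ I) :
    y₂ s = (x₁ s * y₂ s - y₁ s * x₂ s) * x₁ s := by
  linear_combination -y₂ s * h.unit s hs + y₁ s * h.acceleration_orthogonal hs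

theorem exists_const (h : IsProfile I x y x₁ y₁ x₂ y₂) {f : ℝ → ℝ}
    (hf : ∀ s ∈ I, HasDerivAt f 0 s) : ∃ C, ∀ s ∈ I, f s = C :=
  h.isOpen.exists_is_const_of_deriv_eq_zero h.isPreconnected
    (fun s hs => (hf s hs).differentiableAt.differentiableWithinAt) (fun s hs => (hf s hs).deriv)

end IsProfile

/-! ### Plane geometry: tangent directions, rigid motions, lines, asymptotes. -/

theorem hasDerivAt_complexMk {f g : ℝ → ℝ} {f' g' t : ℝ} (hf : HasDerivAt f f' t)
    (hg : HasDerivAt g g' t) : HasDerivAt (fun t => (⟨f t, g t⟩ : ℂ)) ⟨f', g'⟩ t := by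
  have := hf.ofReal_comp.fun_add (hg.ofReal_comp.mul_const Complex.I)
  simpa only [← Complex.mk_eq_add_mul_I] using this

theorem one_mem_tangentConeAt {K : Set ℂ} {c : ℝ → ℂ} {s v : ℝ} (hc : HasDerivAt c (v : ℂ) s)
    (hv : v ≠ 0) (hK : ∀ᶠ t in 𝓝 s, c t ∈ K) : (1 : ℂ) ∈ tangentConeAt ℝ K (c s) := by
  refine mem_tangentConeAt_of_seq (𝓝[≠] s) (fun t => v⁻¹ * (t - s)⁻¹) (fun t => c t - c s) ?_ ?_ ?_
  · have : Tendsto c (𝓝[≠] s) (𝓝 (c s)) := hc.continuousAt.tendsto.mono_left nhdsWithin_le_nhds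
    simpa using this.sub_const (c s)
  · filter_upwards [hK.filter_mono nhdsWithin_le_nhds] with t ht
    simpa using ht
  · have := (hasDerivAt_iff_tendsto_slope.1 hc).const_smul v⁻¹
    have e : v⁻¹ • (v : ℂ) = 1 := by
      rw [Complex.real_smul, ← Complex.ofReal_mul, inv_mul_cancel₀ hv, Complex.ofReal_one]
    rw [e] at this
    simpa only [slope_def_module, smul_smul] using this

theorem mul_conj_of_norm_eq_one {u : ℂ} (hu : ‖u‖ = 1) : u * conj u = 1 := by
  rw [Complex.mul_conj, Complex.normSq_eq_norm_sq, hu]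
  norm_num

theorem mem_image_motion {u w z : ℂ} {K : Set ℂ} (hu : ‖u‖ = 1) :
    z ∈ (fun z => u * z + w) '' K ↔ conj u * (z - w) ∈ K := by
  have h1 := mul_conj_of_norm_eq_one hu
  constructor
  · rintro ⟨q, hq, rfl⟩
    have : conj u * (u * q + w - w) = q := by linear_combination q * h1
    rwa [this]
  · intro h
    exact ⟨_, h, by linear_combination (z - w) * h1⟩

theorem dist_motion_symm {u w z F : ℂ} (hu : ‖u‖ = 1) :
    dist (conj u * (z - w)) F = dist z (u * F + w) := by
  have h1 := mul_conj_of_norm_eq_one hu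
  have : z - (u * F + w) = u * (conj u * (z - w) - F) := by
    linear_combination -(z - w) * h1
  rw [dist_eq_norm, dist_eq_norm, this, norm_mul, hu, one_mul]

/-- Multiplication by `conj (B - A)` makes the line parallel to the real axis, so that the distance
is read off from an imaginary part. -/
theorem infDist_line {A B : ℂ} (hAB : A ≠ B) (z : ℂ) :
    Metric.infDist z (line[ℝ, A, B] : Set ℂ) = |((z - A) * conj (B - A)).im| / ‖B - A‖ := by
  have hpos : 0 < ‖B - A‖ := norm_pos_iff.2 (sub_ne_zero.2 hAB.symm)
  have hline : ∀ t : ℝ, AffineMap.lineMap A B t ∈ (line[ℝ, A, B] : Set ℂ) := fun t =>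
    AffineMap.lineMap_mem_affineSpan_pair t A B
  have hBB : (B - A) * conj (B - A) = ((‖B - A‖ ^ 2 : ℝ) : ℂ) := by
    rw [Complex.mul_conj, Complex.normSq_eq_norm_sq]
  have key : ∀ t : ℝ, (z - AffineMap.lineMap A B t) * conj (B - A)
      = (z - A) * conj (B - A) - ((t * ‖B - A‖ ^ 2 : ℝ) : ℂ) := by
    intro t
    rw [AffineMap.lineMap_apply, vsub_eq_sub, vadd_eq_add, Complex.real_smul, Complex.ofReal_mul,
      ← hBB]
    ring
  apply le_antisymm
  -- The parameter of the foot of the perpendicular from `z`.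
  · set t := ((z - A) * conj (B - A)).re / ‖B - A‖ ^ 2 with ht
    refine (Metric.infDist_le_dist_of_mem (hline t)).trans ?_
    rw [le_div_iff₀ hpos, dist_eq_norm]
    have h2 : (z - AffineMap.lineMap A B t) * conj (B - A)
        = (((z - A) * conj (B - A)).im : ℂ) * Complex.I := by
      rw [key t, ht, div_mul_cancel₀ _ (pow_pos hpos 2).ne']
      nth_rewrite 1 [← Complex.re_add_im ((z - A) * conj (B - A))]
      ring
    calc ‖z - AffineMap.lineMap A B t‖ * ‖B - A‖
        = ‖(z - AffineMap.lineMap A B t) * conj (B - A)‖ := by rw [norm_mul, RCLike.norm_conj]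
      _ ≤ _ := by
        rw [h2, norm_mul, Complex.norm_I, mul_one, Complex.norm_real, Real.norm_eq_abs]
  · refine (Metric.le_infDist ⟨_, hline 0⟩).2 fun w hw => ?_
    obtain ⟨t, rfl⟩ := mem_affineSpan_pair_iff_exists_lineMap_eq.1 hw
    rw [div_le_iff₀ hpos, dist_eq_norm]
    calc |((z - A) * conj (B - A)).im|
        = |((z - AffineMap.lineMap A B t) * conj (B - A)).im| := by
          rw [key t, Complex.sub_im, Complex.ofReal_im, sub_zero]
      _ ≤ ‖(z - AffineMap.lineMap A B t) * conj (B - A)‖ := Complex.abs_im_le_norm _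
      _ = _ := by rw [norm_mul, RCLike.norm_conj]

theorem mem_line_iff {A B : ℂ} (hAB : A ≠ B) (z : ℂ) :
    z ∈ line[ℝ, A, B] ↔ ((z - A) * conj (B - A)).im = 0 := by
  have hpos : 0 < ‖B - A‖ := norm_pos_iff.2 (sub_ne_zero.2 hAB.symm)
  have hcl : IsClosed (line[ℝ, A, B] : Set ℂ) := AffineSubspace.closed_of_finiteDimensional _
  rw [← SetLike.mem_coe, hcl.mem_iff_infDist_zero ⟨A, left_mem_affineSpan_pair ℝ A B⟩,
    infDist_line hAB, div_eq_zero_iff, abs_eq_zero]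
  simp [hpos.ne']

theorem norm_mk (a b : ℝ) : ‖(⟨a, b⟩ : ℂ)‖ = √(a ^ 2 + b ^ 2) := by
  rw [Complex.norm_eq_sqrt_sq_add_sq]

theorem norm_mk_eq {a b r : ℝ} (h : a ^ 2 + b ^ 2 = r ^ 2) : ‖(⟨a, b⟩ : ℂ)‖ = |r| := by
  rw [norm_mk, h, Real.sqrt_sq_eq_abs]

theorem axisAsymptote_mono {K L : Set ℂ} (hK : AxisAsymptote K) (hKL : K ⊆ L) :
    AxisAsymptote L := fun R ε hε =>
  let ⟨q, hq, h⟩ := hK R ε hε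
  ⟨q, hKL hq, h⟩

/-- The axis is an asymptote of the hyperbola with foci `m ± (α + iβ)` and real axis `2|α|`. -/
theorem axisAsymptote_hyperbola {m α β : ℝ} (hα : α ≠ 0) (hβ : β ≠ 0) :
    AxisAsymptote {z | |dist z ⟨m + α, β⟩ - dist z ⟨m - α, -β⟩| = 2 * |α|} := by
  intro R ε hε
  have hN : 0 < |α * β| := abs_pos.2 (mul_ne_zero hα hβ)
  have hα' := abs_pos.2 hα
  have hβ' := abs_pos.2 hβ
  -- `Y` is the height of the point above the axis. The last two bounds make `e`, defined below,
  -- exceed |α| and a quantity large enough to force the norm beyond `R`.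
  obtain ⟨Y, hY0, hYε, hYβ, hY2, hYR⟩ : ∃ Y : ℝ, 0 < Y ∧ Y < ε ∧ Y ≤ |β| ∧ 2 * |α| * Y ≤ |α * β| ∧
      (|R| + |m| + |β| ^ 2 / |α| + 1 + |β| * |β| / |α|) * (2 * Y) ≤ |α * β| := by
    set M := |R| + |m| + |β| ^ 2 / |α| + 1 + |β| * |β| / |α| with hM
    have hM0 : 0 < M := by positivity
    refine ⟨min (min (ε / 2) |β|) (min (|α * β| / (2 * |α|)) (|α * β| / (2 * M))), ?_, ?_, ?_, ?_, ?_⟩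
    · positivity
    · exact ((min_le_left _ _).trans (min_le_left _ _)).trans_lt (by linarith)
    · exact (min_le_left _ _).trans (min_le_right _ _)
    · have := (min_le_right (min (ε / 2) |β|) (min (|α * β| / (2 * |α|)) (|α * β| / (2 * M)))).trans
        (min_le_left _ _)
      rwa [le_div_iff₀ (by positivity), mul_comm] at this
    · have := (min_le_right (min (ε / 2) |β|) (min (|α * β| / (2 * |α|)) (|α * β| / (2 * M)))).trans
        (min_le_right _ _)
      rw [le_div_iff₀ (by positivity)] at this
      linarith
  -- A point at height `Y` with abscissa m + e - βY/α has squared distances to the foci differing by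
  -- 4αe; this value of `e` makes the distances themselves |e - α| and |e + α|. It tends to infinity
  -- as `Y` tends to 0.
  set e := (α ^ 2 * Y ^ 2 + α ^ 2 * β ^ 2 + β ^ 2 * Y ^ 2) / (2 * α * β * Y) with he
  have habs : |α * β| / (2 * Y) ≤ |e| := by
    rw [he, abs_div, div_le_div_iff₀ (by positivity) (by positivity),
      abs_of_nonneg (a := _ + _) (by positivity), show 2 * α * β * Y = α * β * (2 * Y) by ring,
      abs_mul (α * β), abs_of_pos (a := 2 * Y) (by positivity)]
    have h1 : |α * β| * |α * β| = α ^ 2 * β ^ 2 := by rw [abs_mul_abs_self]; ring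
    rw [← mul_assoc, h1]
    gcongr
    nlinarith [sq_nonneg (α * Y), sq_nonneg (β * Y)]
  have hαe : |α| ≤ |e| := by
    refine le_trans ?_ habs
    rw [le_div_iff₀ (by positivity)]
    linarith
  have hRe : |R| + |m| + |β| ^ 2 / |α| + 1 + |β| * |β| / |α| ≤ |e| := by
    refine le_trans ?_ habs
    rw [le_div_iff₀ (by positivity)]
    linarith
  refine ⟨⟨m + (e - β * Y / α), Y⟩, ?_, ?_, ?_⟩
  · have d1 : dist (⟨m + (e - β * Y / α), Y⟩ : ℂ) ⟨m + α, β⟩ = |e - α| := by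
      rw [dist_eq_norm]
      refine norm_mk_eq ?_
      rw [he]
      field_simp
      ring
    have d2 : dist (⟨m + (e - β * Y / α), Y⟩ : ℂ) ⟨m - α, -β⟩ = |e + α| := by
      rw [dist_eq_norm]
      refine norm_mk_eq ?_
      rw [he]
      field_simp
      ring
    rw [mem_ofPred_eq, d1, d2]
    rcases le_total 0 e with h0 | h0
    · rw [abs_of_nonneg h0] at hαe
      have := abs_le.1 hαe
      rw [abs_of_nonneg (a := e - α) (by linarith), abs_of_nonneg (a := e + α) (by linarith),
        show e - α - (e + α) = -(2 * α) by ring, abs_neg, abs_mul, abs_two]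
    · rw [abs_of_nonpos h0] at hαe
      have := abs_le.1 hαe
      rw [abs_of_nonpos (a := e - α) (by linarith), abs_of_nonpos (a := e + α) (by linarith),
        show -(e - α) - -(e + α) = 2 * α by ring, abs_mul, abs_two]
  · refine lt_of_lt_of_le ?_ (Complex.abs_re_le_norm _)
    have h1 : |e| ≤ |m + (e - β * Y / α)| + |m| + |β * Y / α| := by
      calc |e| = |(m + (e - β * Y / α)) - m + β * Y / α| := by congr 1; ring
        _ ≤ _ := (abs_add_le _ _).trans (by gcongr; exact abs_sub _ _)
    have h2 : |β * Y / α| ≤ |β| * |β| / |α| := by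
      rw [abs_div, abs_mul, abs_of_pos hY0]
      gcongr
    have h3 : 0 ≤ |β| ^ 2 / |α| := by positivity
    have := le_abs_self R
    show R < |m + (e - β * Y / α)|
    linarith
  · rwa [abs_of_pos hY0]

/-! ### From constant mean curvature to a rolling conic, a circle or a line. -/

namespace IsProfile

variable {I : Set ℝ} {x y x₁ y₁ x₂ y₂ : ℝ → ℝ} {H C : ℝ}

/-- The first integral `y x' - H y²` of a profile of constant mean curvature `H`. -/
theorem exists_first_integral (h : IsProfile I x y x₁ y₁ x₂ y₂)
    (hH : ∀ s ∈ I, x₁ s / y s - (x₁ s * y₂ s - y₁ s * x₂ s) = 2 * H) :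
    ∃ C, ∀ s ∈ I, y s * x₁ s - H * y s ^ 2 = C := by
  refine h.exists_const fun s hs => ?_
  have h1 := ((h.hy s hs).fun_mul (h.hx₁ s hs)).fun_sub (((h.hy s hs).fun_pow 2).const_mul H)
  refine h1.congr_deriv ?_
  have hy := (h.pos s hs).ne'
  have e := hH s hs
  rw [h.acceleration_fst hs]
  field_simp at e
  norm_num
  linear_combination y₁ s * e

theorem circle_of_first_integral_zero (h : IsProfile I x y x₁ y₁ x₂ y₂) (hH0 : H ≠ 0)
    (hH : ∀ s ∈ I, x₁ s / y s - (x₁ s * y₂ s - y₁ s * x₂ s) = 2 * H)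
    (hC : ∀ s ∈ I, y s * x₁ s - H * y s ^ 2 = 0) :
    ∃ m R : ℝ, ∀ s ∈ I, (x s - m) ^ 2 + y s ^ 2 = R ^ 2 := by
  -- With x' = H y the curvature is -H, so x + y'/H is constant: it is the abscissa of the centre.
  have hx₁ : ∀ s ∈ I, x₁ s = H * y s := fun s hs =>
    mul_left_cancel₀ (h.pos s hs).ne' (by linear_combination hC s hs)
  obtain ⟨m, hm⟩ : ∃ m, ∀ s ∈ I, x s + y₁ s / H = m := by
    refine h.exists_const fun s hs => ?_
    refine ((h.hx s hs).fun_add ((h.hy₁ s hs).div_const H)).congr_deriv ?_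
    have hy := (h.pos s hs).ne'
    have e := hH s hs
    rw [h.acceleration_snd hs]
    rw [show x₁ s / y s = H by rw [hx₁ s hs]; field_simp] at e
    field_simp
    linear_combination -x₁ s * e
  refine ⟨m, 1 / H, fun s hs => ?_⟩
  have hy : y s = x₁ s / H := by rw [hx₁ s hs]; field_simp
  rw [← hm s hs, hy]
  field_simp
  linear_combination h.unit s hs

theorem hasDerivAt_spin (h : IsProfile I x y x₁ y₁ x₂ y₂)
    (hH : ∀ s ∈ I, x₁ s / y s - (x₁ s * y₂ s - y₁ s * x₂ s) = 2 * H) {s : ℝ} (hs : s ∈ I) :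
    HasDerivAt (fun t => (⟨x₁ t - 2 * H * y t, -y₁ t⟩ : ℂ))
      (-Complex.I * (x₁ s / y s : ℝ) * ⟨x₁ s - 2 * H * y s, -y₁ s⟩) s := by
  have hy := (h.pos s hs).ne'
  have e := hH s hs
  refine (hasDerivAt_complexMk ((h.hx₁ s hs).fun_sub ((h.hy s hs).const_mul (2 * H)))
    (h.hy₁ s hs).fun_neg).congr_deriv ?_
  apply Complex.ext
  · simp
    rw [h.acceleration_fst hs]
    linear_combination y₁ s * e
  · simp
    rw [h.acceleration_snd hs]
    have : x₁ s / y s * y s = x₁ s := by field_simp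
    linear_combination -x₁ s * e + 2 * H * this

/-- The spinning vector has constant squared length 1 - 4HC, so normalizing it gives the rotation.
If it vanishes, γ is a horizontal line with x'/y = 2H, and the rotation is written down directly
with that constant speed; the conic is then a circle. -/
theorem exists_rotation (h : IsProfile I x y x₁ y₁ x₂ y₂)
    (hH : ∀ s ∈ I, x₁ s / y s - (x₁ s * y₂ s - y₁ s * x₂ s) = 2 * H)
    (hC : ∀ s ∈ I, y s * x₁ s - H * y s ^ 2 = C) :
    ∃ (u : ℝ → ℂ) (k : ℝ), (∀ s ∈ I, ‖u s‖ = 1) ∧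
      (∀ s ∈ I, HasDerivAt u (-Complex.I * (x₁ s / y s : ℝ) * u s) s) ∧
      ∀ s ∈ I, k * u s = ⟨x₁ s - 2 * H * y s, -y₁ s⟩ := by
  have hD : ∀ s ∈ I, (x₁ s - 2 * H * y s) ^ 2 + (-y₁ s) ^ 2 = 1 - 4 * H * C := fun s hs => by
    rw [← hC s hs]
    linear_combination h.unit s hs
  rcases lt_or_ge 0 (1 - 4 * H * C) with hpos | hneg
  · have hk := Real.sqrt_pos.2 hpos
    refine ⟨fun s => ((√(1 - 4 * H * C))⁻¹ : ℝ) * ⟨x₁ s - 2 * H * y s, -y₁ s⟩,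
      √(1 - 4 * H * C), fun s hs => ?_, fun s hs => ?_, fun s hs => ?_⟩
    · rw [norm_mul, Complex.norm_real, norm_mk, hD s hs, Real.norm_of_nonneg (by positivity),
        inv_mul_cancel₀ hk.ne']
    · refine ((h.hasDerivAt_spin hH hs).const_mul
        (((√(1 - 4 * H * C))⁻¹ : ℝ) : ℂ)).congr_deriv ?_
      ring
    · rw [← mul_assoc, ← Complex.ofReal_mul, mul_inv_cancel₀ hk.ne', Complex.ofReal_one, one_mul]
  · have h0 : ∀ s ∈ I, x₁ s - 2 * H * y s = 0 ∧ -y₁ s = 0 := fun s hs => by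
      have := hD s hs
      constructor <;> nlinarith [sq_nonneg (x₁ s - 2 * H * y s), sq_nonneg (-y₁ s)]
    refine ⟨fun s => Complex.exp (((-2 * H * s : ℝ) : ℂ) * Complex.I), 0, fun s hs => ?_,
      fun s hs => ?_, fun s hs => ?_⟩
    · exact Complex.norm_exp_ofReal_mul_I _
    · have e : x₁ s / y s = 2 * H := by
        have := h.pos s hs
        rw [div_eq_iff this.ne']
        linarith [(h0 s hs).1]
      refine (((hasDerivAt_id' s).const_mul (-2 * H)).ofReal_comp.mul_const
        Complex.I).cexp.congr_deriv ?_
      rw [e]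
      push_cast
      ring
    · rw [(h0 s hs).1, (h0 s hs).2, Complex.ofReal_zero, zero_mul]
      rfl

/-- The motion whose rotational part is `u` and which carries `0` along the profile rolls a set
containing the points of contact. -/
theorem exists_contact (h : IsProfile I x y x₁ y₁ x₂ y₂)
    (hH : ∀ s ∈ I, x₁ s / y s - (x₁ s * y₂ s - y₁ s * x₂ s) = 2 * H)
    (hC : ∀ s ∈ I, y s * x₁ s - H * y s ^ 2 = C) (hC0 : C ≠ 0) {u : ℝ → ℂ}
    (hu : ∀ s ∈ I, ‖u s‖ = 1)
    (hu' : ∀ s ∈ I, HasDerivAt u (-Complex.I * (x₁ s / y s : ℝ) * u s) s) {K : Set ℂ}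
    (hK : ∀ s ∈ I, x₁ s ≠ 0 → conj (u s) * ⟨y s * y₁ s / x₁ s, -y s⟩ ∈ K) {s : ℝ} (hs : s ∈ I)
    (hx₁ : x₁ s ≠ 0) :
    ∃ p ∈ K, AxisTangentAt ((fun z => u s * z + ⟨x s, y s⟩) '' K) (u s * p + ⟨x s, y s⟩) ∧
      deriv (fun t => u t * p + ⟨x t, y t⟩) s = 0 := by
  have hy := (h.pos s hs).ne'
  have h1 := mul_conj_of_norm_eq_one (hu s hs)
  have hq : u s * (conj (u s) * ⟨y s * y₁ s / x₁ s, -y s⟩) = ⟨y s * y₁ s / x₁ s, -y s⟩ := by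
    linear_combination (⟨y s * y₁ s / x₁ s, -y s⟩ : ℂ) * h1
  refine ⟨conj (u s) * ⟨y s * y₁ s / x₁ s, -y s⟩, hK s hs hx₁, ⟨⟨_, hK s hs hx₁, rfl⟩, ?_, ?_⟩, ?_⟩
  · rw [hq]
    simp
  · have hqd : HasDerivAt (fun t => (⟨y t * y₁ t / x₁ t, -y t⟩ : ℂ))
        ⟨((y₁ s * y₁ s + y s * y₂ s) * x₁ s - y s * y₁ s * x₂ s) / x₁ s ^ 2, -y₁ s⟩ s :=
      hasDerivAt_complexMk (((h.hy s hs).fun_mul (h.hy₁ s hs)).fun_div (h.hx₁ s hs) hx₁)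
        (h.hy s hs).fun_neg
    have hcd := ((((hu' s hs).star).fun_mul hqd).const_mul (u s)).add_const
      (⟨x s, y s⟩ : ℂ)
    -- Freeze the moving copy of `K` at time `s`. The contact points of the times `t` form a curve
    -- in this copy, whose velocity at `s` is horizontal and equal to 2C/(y x'²); it is nonzero
    -- because `C` is.
    refine one_mem_tangentConeAt (c := fun t => u s * (star (u t) * ⟨y t * y₁ t / x₁ t, -y t⟩) + ⟨x s, y s⟩)
      (v := 2 * C / (y s * x₁ s ^ 2)) (hcd.congr_deriv ?_) ?_ ?_
    · have e := hH s hs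
      have hstar : ∀ z : ℂ, star z = conj z := fun _ => rfl
      simp only [hstar, map_mul, map_neg, Complex.conj_I, Complex.conj_ofReal]
      have e2 : 2 * C = 2 * (y s * x₁ s - H * y s ^ 2) := by rw [hC s hs]
      trans (Complex.I * (x₁ s / y s : ℝ) * ⟨y s * y₁ s / x₁ s, -y s⟩ +
        ⟨((y₁ s * y₁ s + y s * y₂ s) * x₁ s - y s * y₁ s * x₂ s) / x₁ s ^ 2, -y₁ s⟩)
      · linear_combination (Complex.I * (x₁ s / y s : ℝ) * ⟨y s * y₁ s / x₁ s, -y s⟩ +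
          ⟨((y₁ s * y₁ s + y s * y₂ s) * x₁ s - y s * y₁ s * x₂ s) / x₁ s ^ 2, -y₁ s⟩) * h1
      · apply Complex.ext
        · simp [-Complex.ofReal_div]
          rw [e2]
          field_simp at e ⊢
          linear_combination -e + x₁ s * h.unit s hs
        · simp [-Complex.ofReal_div]
          field_simp
          ring
    · have := h.pos s hs
      positivity
    · filter_upwards [h.isOpen.eventually_mem hs,
        (h.hx₁ s hs).continuousAt.eventually_ne hx₁] with t ht htx
      exact ⟨_, hK t ht htx, rfl⟩
  · have := ((hu' s hs).mul_const (conj (u s) * ⟨y s * y₁ s / x₁ s, -y s⟩)).fun_add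
      (hasDerivAt_complexMk (h.hx s hs) (h.hy s hs))
    rw [this.deriv, mul_assoc (-Complex.I * _), hq]
    apply Complex.ext
    · simp [-Complex.ofReal_div]
      field_simp
      ring
    · simp [-Complex.ofReal_div]
      field_simp
      ring

end IsProfile

namespace IsProfile

variable {I : Set ℝ} {x y x₁ y₁ x₂ y₂ : ℝ → ℝ} {H C : ℝ}

/-- The rotation is the complex conjugate of γ'. In the moving frame the focus is 0, the directrix
is the horizontal line at height -2C, and the contact point is at distance |y/x'| from both. -/
theorem isConicRoulette_of_minimal (h : IsProfile I x y x₁ y₁ x₂ y₂)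
    (hH : ∀ s ∈ I, x₁ s / y s - (x₁ s * y₂ s - y₁ s * x₂ s) = 0)
    (hC : ∀ s ∈ I, y s * x₁ s = C) (hC0 : C ≠ 0) :
    IsConicRoulette (fun s => ⟨x s, y s⟩) I := by
  have hH' : ∀ s ∈ I, x₁ s / y s - (x₁ s * y₂ s - y₁ s * x₂ s) = 2 * 0 := by simpa using hH
  have hC' : ∀ s ∈ I, y s * x₁ s - 0 * y s ^ 2 = C := by simpa using hC
  have hAB : (⟨0, -2 * C⟩ : ℂ) ≠ ⟨1, -2 * C⟩ := by
    simp
  have hinf : ∀ z : ℂ, Metric.infDist z (line[ℝ, (⟨0, -2 * C⟩ : ℂ), ⟨1, -2 * C⟩] : Set ℂ)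
      = |z.im + 2 * C| := by
    intro z
    have e : (⟨1, -2 * C⟩ - ⟨0, -2 * C⟩ : ℂ) = 1 := Complex.ext (by simp) (by simp)
    rw [infDist_line hAB, e]
    simp
  have hu : ∀ s ∈ I, ‖(⟨x₁ s, -y₁ s⟩ : ℂ)‖ = 1 := fun s hs => by
    rw [norm_mk, neg_sq, h.unit s hs, Real.sqrt_one]
  have hu' : ∀ s ∈ I, HasDerivAt (fun s => (⟨x₁ s, -y₁ s⟩ : ℂ))
      (-Complex.I * (x₁ s / y s : ℝ) * ⟨x₁ s, -y₁ s⟩) s := fun s hs => by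
    simpa using h.hasDerivAt_spin hH' hs
  refine ⟨{z | dist z 0 = Metric.infDist z (line[ℝ, (⟨0, -2 * C⟩ : ℂ), ⟨1, -2 * C⟩] : Set ℂ)}, 0,
    fun s => ⟨x₁ s, -y₁ s⟩, fun s => ⟨x s, y s⟩, Or.inr (Or.inl ⟨_, _, hAB, ?_, rfl⟩), ?_, ?_⟩
  · intro h0
    have := Metric.infDist_zero_of_mem h0
    rw [hinf, Complex.zero_im, zero_add, abs_eq_zero] at this
    exact hC0 (by linarith)
  · intro s hs
    have hx₁ : x₁ s ≠ 0 := fun h0 => hC0 (by rw [← hC s hs, h0, mul_zero])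
    refine ⟨hu s hs, (hu' s hs).differentiableAt,
      (hasDerivAt_complexMk (h.hx s hs) (h.hy s hs)).differentiableAt, Or.inl ?_⟩
    refine h.exists_contact hH' hC' hC0 hu hu' ?_ hs hx₁
    intro t ht hx
    have hunit := h.unit t ht
    rw [mem_ofPred_eq, hinf, dist_zero_right, norm_mul, RCLike.norm_conj, hu t ht, one_mul,
      norm_mk_eq (r := y t / x₁ t) (by field_simp; linear_combination y t ^ 2 * hunit), ← hC t ht]
    congr 1
    simp
    field_simp
    linear_combination -y t * hunit
  · intro s _
    simp

theorem isConicRoulette_of_first_integral (h : IsProfile I x y x₁ y₁ x₂ y₂)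
    (hH : ∀ s ∈ I, x₁ s / y s - (x₁ s * y₂ s - y₁ s * x₂ s) = 2 * H)
    (hC : ∀ s ∈ I, y s * x₁ s - H * y s ^ 2 = C) (hH0 : H ≠ 0) (hC0 : C ≠ 0) {s₀ : ℝ}
    (hs₀ : s₀ ∈ I) :
    IsConicRoulette (fun s => ⟨x s, y s⟩) I := by
  obtain ⟨u, k, hu, hu', hk⟩ := h.exists_rotation hH hC
  have hk2 : k ^ 2 = 1 - 4 * (C * H) := by
    have h1 : ‖(k : ℂ) * u s₀‖ ^ 2 = k ^ 2 := by
      rw [norm_mul, hu s₀ hs₀, mul_one, Complex.norm_real, Real.norm_eq_abs, sq_abs]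
    rw [← h1, hk s₀ hs₀, norm_mk, Real.sq_sqrt (by positivity), ← hC s₀ hs₀]
    linear_combination h.unit s₀ hs₀
  have hH' : 0 < |H| := abs_pos.2 hH0
  set g : ℂ := Complex.I * ((k / H : ℝ) : ℂ) with hg
  have hug : ∀ s ∈ I, u s * g = ⟨y₁ s / H, (x₁ s - 2 * H * y s) / H⟩ := by
    intro s hs
    have e : u s * g = Complex.I * ((H⁻¹ : ℝ) : ℂ) * (k * u s) := by
      rw [hg]
      push_cast
      ring
    rw [e, hk s hs]
    apply Complex.ext <;> simp <;> ring
  have hdist : dist (0 : ℂ) g = |k| / |H| := by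
    rw [hg, dist_zero_left, norm_mul, Complex.norm_I, one_mul, Complex.norm_real,
      Real.norm_eq_abs, abs_div]
  have ha : 2 * (1 / (2 * |H|)) = 1 / |H| := by field_simp
  have hp0 : ∀ t ∈ I, x₁ t ≠ 0 →
      dist (conj (u t) * ⟨y t * y₁ t / x₁ t, -y t⟩) 0 = |y t / x₁ t| := by
    intro t ht hx
    rw [dist_zero_right, norm_mul, RCLike.norm_conj, hu t ht, one_mul]
    refine norm_mk_eq ?_
    field_simp
    linear_combination y t ^ 2 * h.unit t ht
  have hpg : ∀ t ∈ I, x₁ t ≠ 0 →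
      dist (conj (u t) * ⟨y t * y₁ t / x₁ t, -y t⟩) g = |y t / x₁ t - 1 / H| := by
    intro t ht hx
    have := dist_motion_symm (u := u t) (w := 0) (z := ⟨y t * y₁ t / x₁ t, -y t⟩) (F := g) (hu t ht)
    rw [sub_zero, add_zero] at this
    rw [this, hug t ht, dist_eq_norm]
    refine norm_mk_eq ?_
    field_simp
    linear_combination (y t * H - x₁ t) ^ 2 * h.unit t ht
  have hprod : ∀ t ∈ I, x₁ t ≠ 0 →
      y t / x₁ t * (1 / H - y t / x₁ t) = C * H * (1 / (H * x₁ t)) ^ 2 := by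
    intro t ht hx
    rw [← hC t ht]
    field_simp
  -- By `hprod` the sign of CH decides whether y/x' and 1/H - y/x' have opposite signs (hyperbola)
  -- or the same sign (ellipse).
  rcases lt_or_gt_of_ne (mul_ne_zero hC0 hH0) with hneg | hpos
  · refine ⟨{z | |dist z 0 - dist z g| = 2 * (1 / (2 * |H|))}, 0, u, fun s => ⟨x s, y s⟩,
      Or.inr (Or.inr ⟨g, 1 / (2 * |H|), by positivity, ?_, rfl⟩), ?_, fun s _ => by simp⟩
    · rw [ha, hdist]
      gcongr
      rw [← abs_one, ← sq_lt_sq, hk2]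
      linarith
    · intro s hs
      have hw := hasDerivAt_complexMk (h.hx s hs) (h.hy s hs)
      refine ⟨hu s hs, (hu' s hs).differentiableAt, hw.differentiableAt, ?_⟩
      by_cases hx₁ : x₁ s = 0
      · right
        have hy₁ : y₁ s ^ 2 = 1 := by simpa [hx₁] using h.unit s hs
        have hy0 : y₁ s ≠ 0 := fun h0 => by simp [h0] at hy₁
        refine ⟨?_, ?_, ?_⟩
        -- When x' = 0 the two foci have opposite heights, so the centre of the hyperbola, their
        -- midpoint, lies on the axis.
        · refine axisAsymptote_mono (axisAsymptote_hyperbola (m := x s + y₁ s / (2 * H))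
            (α := -y₁ s / (2 * H)) (β := y s) (by simp [hy0, hH0]) (h.pos s hs).ne') ?_
          intro z hz
          rw [mem_image_motion (hu s hs), mem_ofPred_eq, dist_motion_symm (hu s hs),
            dist_motion_symm (hu s hs), hug s hs]
          rw [mem_ofPred_eq] at hz
          convert hz using 2
          · congr 2
            · apply Complex.ext <;> simp <;> ring
            · apply Complex.ext
              · simp
                field_simp
                ring
              · simp [hx₁]
                field_simp
                ring
          · have : |y₁ s| = 1 := by rw [← sq_eq_sq₀ (abs_nonneg _) zero_le_one, sq_abs, hy₁, one_pow]
            rw [abs_div, abs_neg, this, abs_mul, abs_two]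
        · rw [(hu' s hs).deriv, hx₁]
          simp
        · rw [hw.deriv, hx₁]
      · left
        refine h.exists_contact hH hC hC0 hu hu' ?_ hs hx₁
        intro t ht hx
        rw [mem_ofPred_eq, hp0 t ht hx, hpg t ht hx, ha]
        have h1 : y t / x₁ t * (y t / x₁ t - 1 / H) ≥ 0 := by
          have := hprod t ht hx
          nlinarith [mul_nonneg (neg_pos.2 hneg).le (sq_nonneg (1 / (H * x₁ t)))]
        have h2 : ∀ a b : ℝ, 0 ≤ a * b → |(|a| - |b|)| = |a - b| := by
          intro a b hab
          rcases mul_nonneg_iff.1 hab with ⟨h1, h2⟩ | ⟨h1, h2⟩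
          · rw [abs_of_nonneg h1, abs_of_nonneg h2]
          · rw [abs_of_nonpos h1, abs_of_nonpos h2, ← abs_neg]
            congr 1
            ring
        rw [h2 _ _ h1, sub_sub_cancel, abs_div, abs_one]
  -- At a zero of x' one would have CH = -H²y² ≤ 0; an ellipse therefore never needs the asymptotic
  -- case.
  · have hx₁ : ∀ s ∈ I, x₁ s ≠ 0 := by
      intro s hs h0
      have := hC s hs
      rw [h0] at this
      rw [← this] at hpos
      nlinarith [sq_nonneg (H * y s)]
    refine ⟨{z | dist z 0 + dist z g = 2 * (1 / (2 * |H|))}, 0, u, fun s => ⟨x s, y s⟩,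
      Or.inl ⟨g, 1 / (2 * |H|), ?_, rfl⟩, ?_, fun s _ => by simp⟩
    · rw [ha, hdist]
      gcongr
      rw [← abs_one, ← sq_lt_sq, hk2]
      linarith
    · intro s hs
      refine ⟨hu s hs, (hu' s hs).differentiableAt,
        (hasDerivAt_complexMk (h.hx s hs) (h.hy s hs)).differentiableAt, Or.inl ?_⟩
      refine h.exists_contact hH hC hC0 hu hu' ?_ hs (hx₁ s hs)
      intro t ht hx
      rw [mem_ofPred_eq, hp0 t ht hx, hpg t ht hx, ha, abs_sub_comm]
      have h1 : 0 ≤ y t / x₁ t * (1 / H - y t / x₁ t) := by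
        rw [hprod t ht hx]
        positivity
      rw [← (abs_add_eq_add_abs_iff _ _).2 (mul_nonneg_iff.1 h1), add_sub_cancel, abs_div, abs_one]

theorem delaunay_of_constant_meanCurvature (h : IsProfile I x y x₁ y₁ x₂ y₂)
    (hH : ∀ s ∈ I, x₁ s / y s - (x₁ s * y₂ s - y₁ s * x₂ s) = 2 * H) :
    IsConicRoulette (fun s => ⟨x s, y s⟩) I ∨
      (∃ m R : ℝ, ∀ s ∈ I, (x s - m) ^ 2 + y s ^ 2 = R ^ 2) ∨ ∃ m : ℝ, ∀ s ∈ I, x s = m := by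
  rcases I.eq_empty_or_nonempty with rfl | ⟨s₀, hs₀⟩
  · exact Or.inr (Or.inr ⟨0, by simp⟩)
  obtain ⟨C, hC⟩ := h.exists_first_integral hH
  by_cases hC0 : C = 0
  · subst hC0
    right
    by_cases hH0 : H = 0
    · right
      refine h.exists_const fun s hs => ?_
      have : x₁ s = 0 := by
        have := hC s hs
        rw [hH0, zero_mul, sub_zero] at this
        exact (mul_eq_zero.1 this).resolve_left (h.pos s hs).ne'
      rw [← this]
      exact h.hx s hs
    · exact Or.inl (h.circle_of_first_integral_zero hH0 hH hC)
  · left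
    by_cases hH0 : H = 0
    · subst hH0
      exact h.isConicRoulette_of_minimal (by simpa using hH) (by simpa using hC) hC0
    · exact h.isConicRoulette_of_first_integral hH hC hH0 hC0 hs₀

end IsProfile

/-! ### Quadrics tangent or asymptotic to the axis. -/

section Quadric

variable {K : Set ℂ} {A B C D E F : ℝ}

/-- The quadratic polynomial restricted to the axis has a double root at the point of tangency. -/
theorem AxisTangentAt.quadric {q : ℂ} (h : AxisTangentAt K q)
    (hK : ∀ z ∈ K, A * z.re ^ 2 + B * z.re * z.im + C * z.im ^ 2 + D * z.re + E * z.im + F = 0) :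
    A * q.re ^ 2 + D * q.re + F = 0 ∧ 2 * A * q.re + D = 0 := by
  obtain ⟨hq, him, ht⟩ := h
  have h0 := hK q hq
  rw [him] at h0
  refine ⟨by linear_combination h0, ?_⟩
  obtain ⟨α, l, hl, c, d, hd, hdK, hcd⟩ := exists_fun_of_mem_tangentConeAt ht
  have ha : Tendsto (fun n => (d n).re) l (𝓝 0) := (Complex.continuous_re.tendsto 0).comp hd
  have hb : Tendsto (fun n => (d n).im) l (𝓝 0) := (Complex.continuous_im.tendsto 0).comp hd
  have hca : Tendsto (fun n => c n * (d n).re) l (𝓝 1) := by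
    simpa [Function.comp_def] using (Complex.continuous_re.tendsto 1).comp hcd
  have hcb : Tendsto (fun n => c n * (d n).im) l (𝓝 0) := by
    simpa [Function.comp_def] using (Complex.continuous_im.tendsto 1).comp hcd
  have hlim := (((hca.const_mul (2 * A * q.re + D)).add (hcb.const_mul (B * q.re + E))).add
    (((ha.const_mul A).add (hb.const_mul B)).mul hca)).add ((hb.const_mul C).mul hcb)
  -- The equation at `q + d n` minus the equation at `q`, multiplied by `c n`; in the limit only the
  -- horizontal partial derivative survives.
  have hzero : (fun n => (2 * A * q.re + D) * (c n * (d n).re) + (B * q.re + E) * (c n * (d n).im)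
      + (A * (d n).re + B * (d n).im) * (c n * (d n).re) + C * (d n).im * (c n * (d n).im))
      =ᶠ[l] fun _ => 0 := by
    filter_upwards [hdK] with n hn
    have := hK _ hn
    rw [Complex.add_re, Complex.add_im, him] at this
    linear_combination c n * this - c n * h0
  have := tendsto_nhds_unique (hlim.congr' hzero) tendsto_const_nhds
  linear_combination this

/-- Along points of `K` with ordinate tending to 0 and unbounded abscissa X, dividing the equation
by X² isolates `A`, and then dividing by X isolates `D`. -/
theorem AxisAsymptote.quadric (h : AxisAsymptote K)
    (hK : ∀ z ∈ K, A * z.re ^ 2 + B * z.re * z.im + C * z.im ^ 2 + D * z.re + E * z.im + F = 0) :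
    A = 0 ∧ D = 0 := by
  have h' : ∀ n : ℕ, ∃ q ∈ K, (n : ℝ) < ‖q‖ ∧ |q.im| < 1 / ((n : ℝ) + 1) := fun n =>
    h n _ (by positivity)
  choose q hqK hqn hqi using h'
  have hY : Tendsto (fun n => (q n).im) atTop (𝓝 0) :=
    squeeze_zero_norm (fun n => (hqi n).le) tendsto_one_div_add_atTop_nhds_zero_nat
  have hX : Tendsto (fun n => |(q n).re|) atTop atTop := by
    refine tendsto_atTop_mono (f := fun n : ℕ => (n : ℝ) - 1) (fun n => ?_)
      (tendsto_atTop_add_const_right _ _ tendsto_natCast_atTop_atTop)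
    have h1 := Complex.norm_le_abs_re_add_abs_im (q n)
    have h2 : 1 / ((n : ℝ) + 1) ≤ 1 := by
      rw [div_le_one (by positivity)]
      linarith [n.cast_nonneg (α := ℝ)]
    linarith [hqn n, hqi n]
  have ht : Tendsto (fun n => (q n).re⁻¹) atTop (𝓝 0) := by
    refine (tendsto_zero_iff_abs_tendsto_zero _).2 ?_
    simp only [Function.comp_def, abs_inv]
    exact hX.inv_tendsto_atTop
  have hne : ∀ᶠ n in atTop, (q n).re ≠ 0 := by
    filter_upwards [hX.eventually_gt_atTop 0] with n hn
    exact abs_pos.1 hn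
  have hA : A = 0 := by
    have hlim := ((((((hY.const_mul B).mul ht).add (((hY.pow 2).const_mul C).mul (ht.pow 2))).add
      (ht.const_mul D)).add ((hY.const_mul E).mul (ht.pow 2))).add ((ht.pow 2).const_mul F)).const_add
      A
    have hzero : (fun n => A + (B * (q n).im * (q n).re⁻¹ + C * (q n).im ^ 2 * (q n).re⁻¹ ^ 2
        + D * (q n).re⁻¹ + E * (q n).im * (q n).re⁻¹ ^ 2 + F * (q n).re⁻¹ ^ 2))
        =ᶠ[atTop] fun _ => 0 := by
      filter_upwards [hne] with n hn
      have := hK _ (hqK n)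
      field_simp
      linear_combination this
    have := tendsto_nhds_unique (hlim.congr' hzero) tendsto_const_nhds
    linear_combination this
  refine ⟨hA, ?_⟩
  have hlim := (((((hY.const_mul B)).add (((hY.pow 2).const_mul C).mul ht)).add
    ((hY.const_mul E).mul ht)).add (ht.const_mul F)).const_add D
  have hzero : (fun n => D + (B * (q n).im + C * (q n).im ^ 2 * (q n).re⁻¹
      + E * (q n).im * (q n).re⁻¹ + F * (q n).re⁻¹)) =ᶠ[atTop] fun _ => 0 := by
    filter_upwards [hne] with n hn
    have := hK _ (hqK n)
    rw [hA] at this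
    field_simp
    linear_combination this
  have := tendsto_nhds_unique (hlim.congr' hzero) tendsto_const_nhds
  linear_combination this

end Quadric

/-! ### From a rolling conic to constant mean curvature. -/

namespace IsProfile

variable {I : Set ℝ} {x y x₁ y₁ x₂ y₂ : ℝ → ℝ} {H : ℝ} {u w : ℝ → ℂ} {K : Set ℂ} {F : ℂ}

theorem constant_meanCurvature_of_spin (h : IsProfile I x y x₁ y₁ x₂ y₂) {k : ℂ}
    (hu' : ∀ s ∈ I, HasDerivAt u (-Complex.I * (x₁ s / y s : ℝ) * u s) s)
    (hk : ∀ s ∈ I, k * u s = ⟨x₁ s - 2 * H * y s, -y₁ s⟩) :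
    ∀ s ∈ I, x₁ s / y s - (x₁ s * y₂ s - y₁ s * x₂ s) = 2 * H := by
  intro s hs
  have h1 := (hasDerivAt_complexMk ((h.hx₁ s hs).fun_sub ((h.hy s hs).const_mul (2 * H)))
    (h.hy₁ s hs).fun_neg)
  have h2 := ((hu' s hs).const_mul k).congr_of_eventuallyEq
    (f₁ := fun t => (⟨x₁ t - 2 * H * y t, -y₁ t⟩ : ℂ))
    ((h.isOpen.eventually_mem hs).mono fun t ht => (hk t ht).symm)
  have e := h1.unique h2
  rw [show k * (-Complex.I * (x₁ s / y s : ℝ) * u s) = -Complex.I * (x₁ s / y s : ℝ) * (k * u s) by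
    ring, hk s hs] at e
  have hre := congrArg Complex.re e
  have him := congrArg Complex.im e
  simp [-Complex.ofReal_div] at hre him
  have hy := (h.pos s hs).ne'
  have hdiv : x₁ s / y s * y s = x₁ s := by field_simp
  linear_combination -x₁ s * him + y₁ s * hre - (x₁ s / y s - 2 * H) * h.unit s hs +
    2 * H * x₁ s * hdiv

/-- The contact point is the centre of the instantaneous rotation, so it lies on the normal of γ and
on the axis. This fixes both its position and the angular velocity -x'/y; at an asymptote the normal
is parallel to the axis and both sides vanish. -/
theorem rolling_cases (h : IsProfile I x y x₁ y₁ x₂ y₂) (hroll : RollsAlongAxis K I u w)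
    (hc : ∀ s ∈ I, (⟨x s, y s⟩ : ℂ) = u s * F + w s) {s : ℝ} (hs : s ∈ I) :
    HasDerivAt u (-Complex.I * (x₁ s / y s : ℝ) * u s) s ∧
    ((x₁ s ≠ 0 ∧ ∃ q, AxisTangentAt ((fun z => u s * z + w s) '' K) q ∧
        q.re = x s + y s * y₁ s / x₁ s) ∨
      (x₁ s = 0 ∧ AxisAsymptote ((fun z => u s * z + w s) '' K))) := by
  obtain ⟨hus, hdu, hdw, hcase⟩ := hroll s hs
  have hU := hdu.hasDerivAt
  have hW := hdw.hasDerivAt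
  have hy := (h.pos s hs).ne'
  have hγ : (⟨x₁ s, y₁ s⟩ : ℂ) = deriv u s * F + deriv w s :=
    (hasDerivAt_complexMk (h.hx s hs) (h.hy s hs)).unique
      (((hU.mul_const F).fun_add hW).congr_of_eventuallyEq
        ((h.isOpen.eventually_mem hs).mono fun t ht => hc t ht))
  rcases hcase with ⟨p, -, htan, hrest⟩ | ⟨hasym, hu0, hw0⟩
  · have h1 := mul_conj_of_norm_eq_one hus
    have hrest' : deriv u s * p + deriv w s = 0 := by
      rw [← hrest, ((hU.mul_const p).fun_add hW).deriv]
    have hskew : deriv u s * conj (u s) + u s * conj (deriv u s) = 0 :=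
      (hU.fun_mul hU.star).unique ((hasDerivAt_const s (1 : ℂ)).congr_of_eventuallyEq
        ((h.isOpen.eventually_mem hs).mono fun t ht => mul_conj_of_norm_eq_one (hroll t ht).1))
    obtain ⟨ω, hω⟩ : ∃ ω : ℝ, deriv u s = Complex.I * ω * u s := by
      have hre : (deriv u s * conj (u s)).re = 0 := by
        have := congrArg Complex.re hskew
        simp at this ⊢
        linarith
      refine ⟨(deriv u s * conj (u s)).im, ?_⟩
      have h2 : deriv u s * conj (u s) = Complex.I * ((deriv u s * conj (u s)).im : ℝ) := by
        nth_rewrite 1 [← Complex.re_add_im (deriv u s * conj (u s)), hre]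
        simp [mul_comm]
      rw [← h2]
      linear_combination -deriv u s * h1
    have hvel : (⟨x₁ s, y₁ s⟩ : ℂ) = Complex.I * ω * (⟨x s, y s⟩ - (u s * p + w s)) := by
      rw [hγ, hc s hs]
      linear_combination (F - p) * hω + hrest'
    have him0 := htan.2.1
    set q := u s * p + w s with hq
    have hre := congrArg Complex.re hvel
    have him := congrArg Complex.im hvel
    simp [him0] at hre him
    -- Since x' = -ωy, x' = 0 would stop the rotation and hence γ, which has unit speed.
    have hx₁ : x₁ s ≠ 0 := by
      intro h0
      have hω0 : ω = 0 := by
        rw [h0] at hre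
        exact (mul_eq_zero.1 (neg_eq_zero.1 hre.symm)).resolve_right hy
      have := h.unit s hs
      rw [h0, him, hω0] at this
      norm_num at this
    refine ⟨?_, Or.inl ⟨hx₁, q, htan, ?_⟩⟩
    · refine hU.congr_deriv ?_
      rw [hω, hre]
      push_cast
      have : (y s : ℂ) ≠ 0 := by exact_mod_cast hy
      field_simp
    · rw [him, hre]
      have hω0 : ω ≠ 0 := fun h0 => hx₁ (by rw [hre, h0]; ring)
      field_simp
      ring
  · have hx₁ : x₁ s = 0 := by
      have := congrArg Complex.re hγ
      rw [hu0] at this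
      simpa [hw0] using this
    refine ⟨?_, Or.inr ⟨hx₁, hasym⟩⟩
    refine hU.congr_deriv ?_
    rw [hu0, hx₁]
    simp

theorem eq_or_eq_neg_const_of_sq_eq (h : IsProfile I x y x₁ y₁ x₂ y₂) {f : ℝ → ℝ} {r : ℝ}
    (hf : ContinuousOn f I) (hr : r ≠ 0) (hsq : ∀ s ∈ I, f s ^ 2 = r ^ 2) :
    ∃ ρ, ρ ^ 2 = r ^ 2 ∧ ∀ s ∈ I, f s = ρ := by
  rcases h.isPreconnected.eq_or_eq_neg_of_sq_eq hf (continuousOn_const (c := r))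
    (fun s hs => hsq s hs) (fun _ => hr) with h1 | h1
  · exact ⟨r, rfl, h1⟩
  · exact ⟨-r, neg_sq r, h1⟩

end IsProfile

/-- If the axis is tangent at `(q, 0)` to the central conic with foci `(x, y)`, `(g, g')` and axis
`2a`, then the line from the second focus to `(q, 0)` is the reflection in the axis of the line
from the first one. -/
theorem reflection_central {x y x₁ y₁ a g g' q : ℝ} (ha : a ≠ 0) (hy : 0 < y) (hx₁ : x₁ ≠ 0)
    (hunit : x₁ ^ 2 + y₁ ^ 2 = 1) (hfoci : (g - x) ^ 2 + (g' - y) ^ 2 ≠ 4 * a ^ 2)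
    (hq : q = x + y * y₁ / x₁)
    (hval : ((q - g) ^ 2 + g' ^ 2 - ((q - x) ^ 2 + y ^ 2)) ^ 2
      - 8 * a ^ 2 * ((q - x) ^ 2 + y ^ 2 + ((q - g) ^ 2 + g' ^ 2)) + 16 * a ^ 4 = 0)
    (hder : ((q - g) ^ 2 + g' ^ 2 - ((q - x) ^ 2 + y ^ 2)) * (x - g)
      - 4 * a ^ 2 * ((q - x) + (q - g)) = 0) :
    ∃ r, r ^ 2 = 4 * a ^ 2 ∧ g = x + r * y₁ ∧ g' = -y + r * x₁ := by
  obtain ⟨t, ht⟩ : ∃ t, y = t * x₁ := ⟨y / x₁, by field_simp⟩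
  have ht0 : t ≠ 0 := fun h0 => by simp [ht, h0] at hy
  have hq' : q - x = t * y₁ := by
    rw [hq, ht]
    field_simp
    ring
  have hd : (q - x) ^ 2 + y ^ 2 = t ^ 2 := by
    rw [hq', ht]
    linear_combination t ^ 2 * hunit
  rw [hd] at hval hder
  set d := (q - g) ^ 2 + g' ^ 2 with hd2
  -- The rationalized conic equation factors: the distance from the contact point to the second
  -- focus is |t - r| with r = ±2a.
  have hsq : (d - t ^ 2 - 4 * a ^ 2) ^ 2 = (4 * a * t) ^ 2 := by linear_combination hval
  have hsign : ∃ r, r ^ 2 = 4 * a ^ 2 ∧ d - t ^ 2 - 4 * a ^ 2 = -2 * r * t := by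
    rcases sq_eq_sq_iff_eq_or_eq_neg.1 hsq with h | h
    · exact ⟨-2 * a, by ring, by linear_combination h⟩
    · exact ⟨2 * a, by ring, by linear_combination h⟩
  obtain ⟨r, hr, hdr⟩ := hsign
  have hr0 : r ≠ 0 := fun h0 => ha (by simpa [h0] using hr.symm)
  have hg : g = x + r * y₁ := by
    refine mul_left_cancel₀ (mul_ne_zero ht0 hr0) ?_
    have e1 : d = t ^ 2 + r ^ 2 - 2 * r * t := by linear_combination hdr - hr
    rw [e1] at hder
    linear_combination (1 / 2) * hder + r ^ 2 * hq' - (1 / 2) * (q - x + (q - g)) * hr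
  refine ⟨r, hr, hg, ?_⟩
  have hg2 : g' ^ 2 = (y - r * x₁) ^ 2 := by
    have e1 : d = t ^ 2 + r ^ 2 - 2 * r * t := by linear_combination hdr - hr
    have e2 : q - g = (t - r) * y₁ := by linear_combination hq' - hg
    rw [hd2, e2] at e1
    rw [ht]
    linear_combination e1 - (t - r) ^ 2 * hunit
  rcases sq_eq_sq_iff_eq_or_eq_neg.1 hg2 with h | h
  -- With this sign the second focus itself, not its mirror image, lies on the normal, at distance
  -- 2|a| from the first: a degenerate conic.
  · refine absurd ?_ hfoci
    rw [hg, h, ← hr]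
    linear_combination r ^ 2 * hunit
  · linear_combination h

namespace IsProfile

variable {I : Set ℝ} {x y x₁ y₁ x₂ y₂ : ℝ → ℝ} {u w : ℝ → ℂ} {K : Set ℂ} {F : ℂ}

/-- The hypothesis on `K` is the equation of the conic with the square roots cleared; it covers
ellipses and both branches of hyperbolas at once. -/
theorem constant_meanCurvature_of_central_roulette (h : IsProfile I x y x₁ y₁ x₂ y₂)
    (hroll : RollsAlongAxis K I u w) (hc : ∀ s ∈ I, (⟨x s, y s⟩ : ℂ) = u s * F + w s) {G : ℂ}
    {a : ℝ} (ha : a ≠ 0) (hFG : dist F G ^ 2 ≠ 4 * a ^ 2)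
    (hK : ∀ z ∈ K, (dist z G ^ 2 - dist z F ^ 2) ^ 2 - 8 * a ^ 2 * (dist z F ^ 2 + dist z G ^ 2)
      + 16 * a ^ 4 = 0) :
    ∃ H, ∀ s ∈ I, x₁ s / y s - (x₁ s * y₂ s - y₁ s * x₂ s) = 2 * H := by
  have hu' := fun s hs => (h.rolling_cases hroll hc hs (s := s)).1
  set g : ℝ → ℂ := fun s => ⟨x s, y s⟩ + u s * (G - F) with hg
  have hgc : ContinuousOn g I := fun s hs =>
    ((hasDerivAt_complexMk (h.hx s hs) (h.hy s hs)).continuousAt.add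
      ((hu' s hs).continuousAt.mul continuousAt_const)).continuousWithinAt
  have hdist : ∀ z v : ℂ, dist z v ^ 2 = (z.re - v.re) ^ 2 + (z.im - v.im) ^ 2 := fun z v => by
    rw [dist_eq_norm, Complex.sq_norm, Complex.normSq_apply]
    simp
    ring
  have hfoci : ∀ s ∈ I, ((g s).re - x s) ^ 2 + ((g s).im - y s) ^ 2 ≠ 4 * a ^ 2 := by
    intro s hs
    have e : dist (g s) ⟨x s, y s⟩ = dist F G := by
      rw [dist_eq_norm, hg, add_sub_cancel_left, norm_mul, (hroll s hs).1, one_mul, dist_comm,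
        dist_eq_norm]
    rw [← e, hdist] at hFG
    exact hFG
  have hrefl : ∀ s ∈ I, ∃ r, r ^ 2 = 4 * a ^ 2 ∧ (g s).re = x s + r * y₁ s ∧
      (g s).im = -y s + r * x₁ s := by
    intro s hs
    have hus := (hroll s hs).1
    have hQ : ∀ z ∈ (fun z => u s * z + w s) '' K,
        (((z.re - (g s).re) ^ 2 + (z.im - (g s).im) ^ 2)
          - ((z.re - x s) ^ 2 + (z.im - y s) ^ 2)) ^ 2
        - 8 * a ^ 2 * (((z.re - x s) ^ 2 + (z.im - y s) ^ 2)
          + ((z.re - (g s).re) ^ 2 + (z.im - (g s).im) ^ 2)) + 16 * a ^ 4 = 0 := by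
      intro z hz
      have h1 := hK _ ((mem_image_motion hus).1 hz)
      have h2 : u s * G + w s = g s := by
        rw [hg]
        simp only [hc s hs]
        ring
      rw [dist_motion_symm hus, dist_motion_symm hus, ← hc s hs, h2, hdist, hdist] at h1
      exact h1
    have hunit := h.unit s hs
    set g₁ := (g s).re
    set g₂ := (g s).im
    have hquad : ∀ z ∈ (fun z => u s * z + w s) '' K,
        (4 * (g₁ - x s) ^ 2 - 16 * a ^ 2) * z.re ^ 2
        + (8 * (g₁ - x s) * (g₂ - y s)) * z.re * z.im
        + (4 * (g₂ - y s) ^ 2 - 16 * a ^ 2) * z.im ^ 2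
        + (-4 * (g₁ - x s) * (g₁ ^ 2 + g₂ ^ 2 - x s ^ 2 - y s ^ 2)
            + 16 * a ^ 2 * (x s + g₁)) * z.re
        + (-4 * (g₂ - y s) * (g₁ ^ 2 + g₂ ^ 2 - x s ^ 2 - y s ^ 2)
            + 16 * a ^ 2 * (y s + g₂)) * z.im
        + ((g₁ ^ 2 + g₂ ^ 2 - x s ^ 2 - y s ^ 2) ^ 2
            - 8 * a ^ 2 * (g₁ ^ 2 + g₂ ^ 2 + x s ^ 2 + y s ^ 2) + 16 * a ^ 4) = 0 := by
      intro z hz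
      linear_combination hQ z hz
    rcases (h.rolling_cases hroll hc hs).2 with ⟨hx₁, q, hq, hqre⟩ | ⟨hx₁, hasym⟩
    · obtain ⟨hval, hder⟩ := hq.quadric hquad
      refine reflection_central ha (h.pos s hs) hx₁ hunit (hfoci s hs) hqre ?_ ?_
      · linear_combination hval
      · linear_combination (1 / 4) * hder
    · obtain ⟨hA, hD⟩ := hasym.quadric hquad
      have hy₁ : y₁ s ^ 2 = 1 := by simpa [hx₁] using hunit
      have h1 : (g₁ - x s) ^ 2 = 4 * a ^ 2 := by linear_combination (1 / 4) * hA
      have h0 : g₁ - x s ≠ 0 := fun h0 => ha (by simpa [h0] using h1.symm)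
      have h2 : g₂ ^ 2 = y s ^ 2 := by
        refine mul_left_cancel₀ h0 ?_
        linear_combination -(1 / 4) * hD - (x s + g₁) * h1
      have h3 : g₂ = -y s := by
        rcases sq_eq_sq_iff_eq_or_eq_neg.1 h2 with h3 | h3
        · refine absurd ?_ (hfoci s hs)
          change (g₁ - x s) ^ 2 + (g₂ - y s) ^ 2 = _
          rw [h3, h1]
          ring
        · exact h3
      refine ⟨(g₁ - x s) * y₁ s, ?_, ?_, ?_⟩
      · rw [mul_pow, hy₁, h1, mul_one]
      · linear_combination -(g₁ - x s) * hy₁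
      · rw [hx₁, h3]
        ring
  -- At each time r = ±2a. It is a continuous function of time, so the sign is constant on the
  -- interval; then H = 1/r.
  obtain ⟨r, hr, hconst⟩ := h.eq_or_eq_neg_const_of_sq_eq
    (f := fun s => ((g s).re - x s) * y₁ s + ((g s).im + y s) * x₁ s) (r := 2 * a) (fun s hs =>
      ((((Complex.continuous_re.comp_continuousOn hgc) s hs).sub
        (h.hx s hs).continuousAt.continuousWithinAt).mul
        (h.hy₁ s hs).continuousAt.continuousWithinAt).add
      ((((Complex.continuous_im.comp_continuousOn hgc) s hs).add
        (h.hy s hs).continuousAt.continuousWithinAt).mul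
        (h.hx₁ s hs).continuousAt.continuousWithinAt)) (by simpa using ha) (fun s hs => by
      obtain ⟨r, hr, e1, e2⟩ := hrefl s hs
      simp only [e1, e2]
      have e : (x s + r * y₁ s - x s) * y₁ s + (-y s + r * x₁ s + y s) * x₁ s = r := by
        linear_combination r * h.unit s hs
      rw [e, hr]
      ring)
  have hr0 : r ≠ 0 := fun h0 => ha (by simpa [h0] using hr.symm)
  refine ⟨1 / r, h.constant_meanCurvature_of_spin (k := -Complex.I * ((1 / r : ℝ) : ℂ) * (G - F))
    hu' fun s hs => ?_⟩
  obtain ⟨r', hr', e1, e2⟩ := hrefl s hs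
  have hrr : r' = r := by
    rw [← hconst s hs, e1, e2]
    linear_combination -r' * h.unit s hs
  rw [hrr] at e1 e2
  have hug : u s * (G - F) = ⟨r * y₁ s, r * x₁ s - 2 * y s⟩ := by
    have e : u s * (G - F) = g s - ⟨x s, y s⟩ := by rw [hg]; ring
    rw [e]
    apply Complex.ext
    · simp [e1]
    · simp [e2]
      ring
  rw [mul_assoc, mul_comm (G - F), hug]
  apply Complex.ext <;> simp <;> field_simp

/-- Here `β` is a unit direction of the directrix. The reflection property makes the moved directrix
parallel to the mirror image (x', -y') of the tangent of γ, which is the spinning vector for H = 0.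
-/
theorem constant_meanCurvature_of_parabolic_roulette (h : IsProfile I x y x₁ y₁ x₂ y₂)
    (hroll : RollsAlongAxis K I u w) (hc : ∀ s ∈ I, (⟨x s, y s⟩ : ℂ) = u s * F + w s) {A β : ℂ}
    (hβ : ‖β‖ = 1) (hF : ((F - A) * conj β).im ≠ 0)
    (hK : ∀ z ∈ K, dist z F ^ 2 = ((z - A) * conj β).im ^ 2) :
    ∀ s ∈ I, x₁ s / y s - (x₁ s * y₂ s - y₁ s * x₂ s) = 2 * 0 := by
  have hu' := fun s hs => (h.rolling_cases hroll hc hs (s := s)).1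
  set b : ℝ → ℂ := fun s => u s * β with hb
  have hbc : ContinuousOn b I := fun s hs =>
    ((hu' s hs).continuousAt.mul continuousAt_const).continuousWithinAt
  set δ := ((F - A) * conj β).im with hδ
  have hrefl : ∀ s ∈ I, ∃ η : ℝ, η ^ 2 = 1 ∧ (b s).re = η * x₁ s ∧ (b s).im = -(η * y₁ s) := by
    intro s hs
    have hus := (hroll s hs).1
    have h1 := mul_conj_of_norm_eq_one hus
    have hbunit : (b s).re ^ 2 + (b s).im ^ 2 = 1 := by
      have : ‖b s‖ ^ 2 = 1 := by rw [hb, norm_mul, hus, hβ]; norm_num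
      rw [Complex.sq_norm, Complex.normSq_apply] at this
      linear_combination this
    have hQ : ∀ z ∈ (fun z => u s * z + w s) '' K,
        (z.re - x s) ^ 2 + (z.im - y s) ^ 2
          = (δ + (z.im - y s) * (b s).re - (z.re - x s) * (b s).im) ^ 2 := by
      intro z hz
      have h2 := hK _ ((mem_image_motion hus).1 hz)
      rw [dist_motion_symm hus, ← hc s hs, dist_eq_norm, Complex.sq_norm,
        Complex.normSq_apply] at h2
      have e : (conj (u s) * (z - w s) - A) * conj β
          = (F - A) * conj β + (z - ⟨x s, y s⟩) * conj (b s) := by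
        rw [hb, hc s hs, map_mul]
        linear_combination F * conj β * h1
      rw [e, Complex.add_im, ← hδ] at h2
      simp at h2
      linear_combination h2
    have hunit := h.unit s hs
    set b₁ := (b s).re
    set b₂ := (b s).im
    have hquad : ∀ z ∈ (fun z => u s * z + w s) '' K,
        (1 - b₂ ^ 2) * z.re ^ 2 + (2 * b₁ * b₂) * z.re * z.im + (1 - b₁ ^ 2) * z.im ^ 2
        + (-2 * x s + 2 * b₂ * (δ - y s * b₁ + x s * b₂)) * z.re
        + (-2 * y s - 2 * b₁ * (δ - y s * b₁ + x s * b₂)) * z.im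
        + (x s ^ 2 + y s ^ 2 - (δ - y s * b₁ + x s * b₂) ^ 2) = 0 := by
      intro z hz
      linear_combination hQ z hz
    rcases (h.rolling_cases hroll hc hs).2 with ⟨hx₁, q, hq, hqre⟩ | ⟨hx₁, hasym⟩
    · obtain ⟨hval, hder⟩ := hq.quadric hquad
      have hy := h.pos s hs
      obtain ⟨t, ht⟩ : ∃ t, y s = t * x₁ s := ⟨y s / x₁ s, by field_simp⟩
      have ht0 : t ≠ 0 := fun h0 => by simp [ht, h0] at hy
      have hq' : q.re - x s = t * y₁ s := by
        rw [hqre, ht]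
        field_simp
        ring
      obtain ⟨M, hM⟩ : ∃ M, δ - y s * b₁ - t * y₁ s * b₂ = M := ⟨_, rfl⟩
      have hMsq : M ^ 2 = t ^ 2 := by
        rw [← hM, ← hq']
        have : (q.re - x s) ^ 2 + y s ^ 2 = t ^ 2 := by
          rw [hq', ht]
          linear_combination t ^ 2 * hunit
        linear_combination this - hval
      have hder' : t * y₁ s + b₂ * M = 0 := by
        rw [← hM, ← hq']
        linear_combination (1 / 2) * hder
      obtain ⟨η, hη, hMη⟩ : ∃ η : ℝ, η ^ 2 = 1 ∧ M = η * t := by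
        rcases sq_eq_sq_iff_eq_or_eq_neg.1 hMsq with e | e
        · exact ⟨1, by norm_num, by rw [e]; ring⟩
        · exact ⟨-1, by norm_num, by rw [e]; ring⟩
      have hb₂ : b₂ = -(η * y₁ s) := by
        refine mul_left_cancel₀ ht0 ?_
        rw [hMη] at hder'
        linear_combination η * hder' - b₂ * t * hη
      refine ⟨η, hη, ?_, hb₂⟩
      have hb₁ : b₁ ^ 2 = (η * x₁ s) ^ 2 := by
        rw [hb₂] at hbunit
        linear_combination hbunit - η ^ 2 * hunit - hη
      rcases sq_eq_sq_iff_eq_or_eq_neg.1 hb₁ with e | e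
      · exact e
      -- The other sign would put the focus on the directrix.
      · refine absurd ?_ hF
        rw [e, hb₂, hMη, ht] at hM
        linear_combination hM - η * t * hunit
    -- A parabola has no asymptote: the directrix would be vertical and would contain the focus.
    · obtain ⟨hA, hD⟩ := hasym.quadric hquad
      have hb₁ : b₁ = 0 := by
        have : b₁ ^ 2 = 0 := by linear_combination hbunit + hA
        simpa using this
      have hb₂ : b₂ ≠ 0 := fun h0 => by norm_num [h0] at hA
      refine absurd ?_ hF
      rw [hb₁] at hD
      refine mul_left_cancel₀ hb₂ ?_
      linear_combination (1 / 2) * hD + x s * hA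
  obtain ⟨η, hη, hconst⟩ := h.eq_or_eq_neg_const_of_sq_eq
    (f := fun s => (b s).re * x₁ s - (b s).im * y₁ s) (r := 1) (fun s hs =>
      (((Complex.continuous_re.comp_continuousOn hbc) s hs).mul
        (h.hx₁ s hs).continuousAt.continuousWithinAt).sub
      (((Complex.continuous_im.comp_continuousOn hbc) s hs).mul
        (h.hy₁ s hs).continuousAt.continuousWithinAt)) one_ne_zero (fun s hs => by
      obtain ⟨η, hη, e1, e2⟩ := hrefl s hs
      simp only [e1, e2]
      have e : η * x₁ s * x₁ s - -(η * y₁ s) * y₁ s = η := by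
        linear_combination η * h.unit s hs
      rw [e, hη, one_pow])
  refine h.constant_meanCurvature_of_spin (k := (η : ℂ) * β) hu' fun s hs => ?_
  obtain ⟨η', hη', e1, e2⟩ := hrefl s hs
  have hηη : η' = η := by
    rw [← hconst s hs, e1, e2]
    linear_combination -η' * h.unit s hs
  rw [hηη] at e1 e2 hη'
  rw [mul_assoc, mul_comm β]
  change (η : ℂ) * b s = _
  apply Complex.ext
  · simp [e1]
    linear_combination x₁ s * hη'
  · simp [e2]
    linear_combination y₁ s * hη'

theorem constant_meanCurvature_of_roulette (h : IsProfile I x y x₁ y₁ x₂ y₂)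
    (hr : IsConicRoulette (fun s => ⟨x s, y s⟩) I) :
    ∃ H, ∀ s ∈ I, x₁ s / y s - (x₁ s * y₂ s - y₁ s * x₂ s) = 2 * H := by
  obtain ⟨K, F, u, w, hconic, hroll, hc⟩ := hr
  rcases hconic with ⟨G, a, hFG, rfl⟩ | ⟨A, B, hAB, hF, rfl⟩ | ⟨G, a, ha, hFG, rfl⟩
  · have h0 : 0 ≤ dist F G := dist_nonneg
    have ha : 0 < a := by linarith
    refine h.constant_meanCurvature_of_central_roulette hroll hc (G := G) ha.ne' ?_ ?_
    · intro e
      nlinarith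
    · intro z hz
      have hz' : dist z F + dist z G = 2 * a := hz
      have e : a = (dist z F + dist z G) / 2 := by linarith
      rw [e]
      ring
  · have hpos : 0 < ‖B - A‖ := norm_pos_iff.2 (sub_ne_zero.2 hAB.symm)
    have him : ∀ z : ℂ, ((z - A) * conj ((‖B - A‖⁻¹ : ℝ) * (B - A))).im
        = ((z - A) * conj (B - A)).im / ‖B - A‖ := by
      intro z
      rw [map_mul, Complex.conj_ofReal, mul_left_comm, Complex.im_ofReal_mul]
      ring
    refine ⟨0, h.constant_meanCurvature_of_parabolic_roulette hroll hc (A := A)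
      (β := (‖B - A‖⁻¹ : ℝ) * (B - A)) ?_ ?_ ?_⟩
    · rw [norm_mul, Complex.norm_real, Real.norm_of_nonneg (by positivity),
        inv_mul_cancel₀ hpos.ne']
    · rw [him]
      exact div_ne_zero (fun e => hF ((mem_line_iff hAB F).2 e)) hpos.ne'
    · intro z hz
      have hz' : dist z F = Metric.infDist z (line[ℝ, A, B] : Set ℂ) := hz
      rw [hz', infDist_line hAB, him, div_pow, div_pow, sq_abs]
  · refine h.constant_meanCurvature_of_central_roulette hroll hc (G := G) ha.ne' ?_ ?_
    · intro e
      nlinarith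
    · intro z hz
      have hz' : |dist z F - dist z G| = 2 * a := hz
      have e : a = |dist z F - dist z G| / 2 := by linarith
      have e2 : a ^ 2 = (dist z F - dist z G) ^ 2 / 4 := by
        rw [e, div_pow, sq_abs]
        norm_num
      rw [show a ^ 4 = (a ^ 2) ^ 2 by ring, e2]
      ring

/-! ### Circles and vertical lines. -/

theorem constant_meanCurvature_of_circle (h : IsProfile I x y x₁ y₁ x₂ y₂) {m R : ℝ}
    (hcirc : ∀ s ∈ I, (x s - m) ^ 2 + y s ^ 2 = R ^ 2) :
    ∃ H, ∀ s ∈ I, x₁ s / y s - (x₁ s * y₂ s - y₁ s * x₂ s) = 2 * H := by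
  rcases I.eq_empty_or_nonempty with rfl | ⟨s₀, hs₀⟩
  · exact ⟨0, by simp⟩
  have hR : R ≠ 0 := by
    rintro rfl
    nlinarith [hcirc s₀ hs₀, h.pos s₀ hs₀, sq_nonneg (x s₀ - m), pow_pos (h.pos s₀ hs₀) 2]
  have hder : ∀ s ∈ I, (x s - m) * x₁ s + y s * y₁ s = 0 := by
    intro s hs
    have h1 := (((h.hx s hs).sub_const m).fun_pow 2).fun_add ((h.hy s hs).fun_pow 2)
    have h2 := (hasDerivAt_const s (R ^ 2)).congr_of_eventuallyEq
      (f₁ := fun s => (x s - m) ^ 2 + y s ^ 2)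
      ((h.isOpen.eventually_mem hs).mono fun t ht => hcirc t ht)
    have := h1.unique h2
    norm_num at this
    linarith
  -- The radius vector is orthogonal to the unit tangent, hence equals r(-y', x') with r = ±R, the
  -- sign being constant by connectedness.
  obtain ⟨r, hr, hconst⟩ := h.eq_or_eq_neg_const_of_sq_eq
    (f := fun s => y s * x₁ s - (x s - m) * y₁ s) (r := R) (fun s hs =>
      (((h.hy s hs).continuousAt.mul (h.hx₁ s hs).continuousAt).sub
        (((h.hx s hs).continuousAt.sub continuousAt_const).mul
          (h.hy₁ s hs).continuousAt)).continuousWithinAt) hR (fun s hs => by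
      linear_combination (y s ^ 2 + (x s - m) ^ 2) * h.unit s hs + hcirc s hs
        - ((x s - m) * x₁ s + y s * y₁ s) * hder s hs)
  have hr0 : r ≠ 0 := fun h0 => hR (by simpa [h0] using hr.symm)
  have hy : ∀ s ∈ I, y s = r * x₁ s := fun s hs => by
    linear_combination x₁ s * hconst s hs + y₁ s * hder s hs - y s * h.unit s hs
  have hx : ∀ s ∈ I, x s - m = -(r * y₁ s) := fun s hs => by
    linear_combination -y₁ s * hconst s hs + x₁ s * hder s hs - (x s - m) * h.unit s hs
  have hx₁ : ∀ s ∈ I, x₁ s = -(r * y₂ s) := fun s hs =>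
    ((h.hx s hs).sub_const m).unique (((h.hy₁ s hs).const_mul r).fun_neg.congr_of_eventuallyEq
      ((h.isOpen.eventually_mem hs).mono fun t ht => hx t ht))
  have hy₁ : ∀ s ∈ I, y₁ s = r * x₂ s := fun s hs =>
    (h.hy s hs).unique (((h.hx₁ s hs).const_mul r).congr_of_eventuallyEq
      ((h.isOpen.eventually_mem hs).mono fun t ht => hy t ht))
  refine ⟨1 / r, fun s hs => ?_⟩
  have hys := (h.pos s hs).ne'
  have e1 : x₁ s / y s = 1 / r := by
    rw [div_eq_div_iff hys hr0]
    linear_combination -hy s hs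
  rw [e1]
  field_simp
  linear_combination -x₁ s * hx₁ s hs - y₁ s * hy₁ s hs + h.unit s hs

theorem meanCurvature_eq_zero_of_vertical (h : IsProfile I x y x₁ y₁ x₂ y₂) {m : ℝ}
    (hm : ∀ s ∈ I, x s = m) :
    ∀ s ∈ I, x₁ s / y s - (x₁ s * y₂ s - y₁ s * x₂ s) = 2 * 0 := by
  have hx₁ : ∀ s ∈ I, x₁ s = 0 := fun s hs =>
    (h.hx s hs).unique ((hasDerivAt_const s m).congr_of_eventuallyEq
      ((h.isOpen.eventually_mem hs).mono fun t ht => hm t ht))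
  intro s hs
  have hx₂ : x₂ s = 0 := (h.hx₁ s hs).unique ((hasDerivAt_const s 0).congr_of_eventuallyEq
      ((h.isOpen.eventually_mem hs).mono fun t ht => hx₁ t ht))
  rw [hx₁ s hs, hx₂]
  simp

end IsProfile

end Delaunay

theorem mainTheorem4 (I : Set ℝ) (hIopen : IsOpen I) (hIconn : I.OrdConnected)
    (γ : ℝ → Fin 3 → ℝ) (hγ : ContDiffOn ℝ 2 γ I)
    (hplane : ∀ s ∈ I, γ s 2 = 0) (hpos : ∀ s ∈ I, 0 < γ s 1)
    (hunit : ∀ s ∈ I, Delaunay.minkowski (deriv γ s) (deriv γ s) = 1) :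
    (∃ H : ℝ, ∀ s ∈ I, ∀ θ : ℝ,
        Delaunay.meanCurvature (Delaunay.revolutionSurface γ) s θ = H) ↔
      (Delaunay.IsConicRoulette (fun s => Delaunay.toPlane (γ s)) I ∨
        (∃ m R : ℝ, ∀ s ∈ I, (γ s 0 - m) ^ 2 + (γ s 1) ^ 2 = R ^ 2) ∨
        (∃ m : ℝ, ∀ s ∈ I, γ s 0 = m)) := by
  have h := Delaunay.isProfile_of_contDiffOn hIopen hIconn hγ hplane hpos hunit
  constructor
  · rintro ⟨H, hH⟩
    refine h.delaunay_of_constant_meanCurvature (H := H) fun s hs => ?_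
    have := hH s hs 0
    rw [Delaunay.meanCurvature_revolutionSurface h hplane hs] at this
    linear_combination 2 * this
  · intro hcase
    obtain ⟨H, hH⟩ : ∃ H, ∀ s ∈ I, deriv γ s 0 / γ s 1 - (deriv γ s 0 * deriv (deriv γ) s 1
        - deriv γ s 1 * deriv (deriv γ) s 0) = 2 * H := by
      rcases hcase with hr | ⟨m, R, hcirc⟩ | ⟨m, hm⟩
      · exact h.constant_meanCurvature_of_roulette hr
      · exact h.constant_meanCurvature_of_circle hcirc
      · exact ⟨0, h.meanCurvature_eq_zero_of_vertical hm⟩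
    refine ⟨H, fun s hs θ => ?_⟩
    rw [Delaunay.meanCurvature_revolutionSurface h hplane hs]
    linear_combination (1 / 2) * hH s hs
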